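/- **Setting.** Let $T>0$, let $\Omega\subset\mathbb R^d$ be bounded and open (for instance a bounded Lipschitz domain), and let $\hat p\in[1,\infty)$. Let $X,U_0$ be reflexive real Banach spaces and let $V,W,Y,\tilde V,H$ be separable reflexive real Banach spaces with continuous embeddings $$U_0\hookrightarrow H\hookrightarrow W,\quad V\hookrightarrow H\hookrightarrow\tilde V\hookrightarrow W,\quad V\hookrightarrow Y,\quad V\hookrightarrow L^{\hat p}(\Omega)\hookrightarrow W,$$ the embedding $V\hookrightarrow L^{\hat p}(\Omega)$ being compact, and with $L^{\hat p}(\Omega)\hookrightarrow\tilde V$ or $\tilde V\hookrightarrow L^{\hat p}(\Omega)$; different chains of these embeddings (other than $V\hookrightarrow Y$) between the same two spaces agree. Put $\mathcal V=L^2(0,T;V)\cap H^1(0,T;\tilde V)$ with norm $\big(\int_0^T\|u(t)\|_V^2+\|\dot u(t)\|_{\tilde V}^2\,dt\big)^{1/2}$, $\mathcal W=L^2(0,T;W)$, $\mathcal Y=L^2(0,T;Y)$, and assume $\mathcal V\hookrightarrow L^\infty((0,T)\times\Omega)$ and $\mathcal V\hookrightarrow C([0,T];H)$ continuously. Let $M:\mathcal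 V\to\mathcal Y$ be bounded and linear. Let $F:(0,T)\times X\times V\to W$ be such that for every $\lambda\in X$, $F(\cdot,\lambda,v)$ is measurable for all $v\in V$ and $F(t,\lambda,\cdot)$ is continuous for a.e. $t$, and such that for a.e. $t$ and all $\lambda\in X$, $v\in V$, $$\|F(t,\lambda,v)\|_W\le\mathcal B(\|\lambda\|_X,\|v\|_H)\,(\gamma(t)+\|v\|_V),$$ where $\gamma\in L^2(0,T)$ and $\mathcal B:\mathbb R^2\to\mathbb R$ is increasing in its second argument. Then $[F(\lambda,u)](t)=F(t,\lambda,u(t))$ defines a map $X\times\mathcal V\to\mathcal W$. Let $\sigma:\mathbb R\to\mathbb R$ be locally Lipschitz, fix a depth $L\ge1$ and widths $n_0=m+1,n_1,\dots,n_L=1$, and let $\Theta$ be the finite-dimensional space of all $\theta=(\omega^l,\beta^l)_{l=1}^L$ with $\omega^l\in\mathcal L(\mathbb R^{n_{l-1}},\mathbb R^{n_l})$ and $\beta^l\in\mathbb R^{n_l}$. Let $\mathcal N_\theta:\mathbb R^m\times\mathbb R\to\mathbb R$ be the network $L_{\theta_L}\circ\dots\circ L_{\theta_1}$ with layers $L_{\theta_l}(z)=\sigma(\omega^lz+\beta^l)$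 ($\sigma$ acting coordinatewise) for $l<L$ and $L_{\theta_L}(z)=\omega^Lz+\beta^L$. It induces $[\mathcal N_\theta(\alpha,u)](t)(x)=\mathcal N_\theta(\alpha,u(t,x))$, a map $\mathbb R^m\times\mathcal V\to L^2(0,T;L^{\hat p}(\Omega))\hookrightarrow\mathcal W$. Define $\mathcal G:X\times\mathbb R^m\times U_0\times\mathcal V\times\Theta\to\mathcal W\times H\times\mathcal Y$ by $$\mathcal G(\lambda,\alpha,u_0,u,\theta)=(\dot u-F(\lambda,u)-\mathcal N_\theta(\alpha,u),\;u(0)-u_0,\;Mu),$$ where $\|(w,h,y)\|^2=\|w\|_{\mathcal W}^2+\|h\|_H^2+\|y\|_{\mathcal Y}^2$. **Structural assumption.** Assume that one of the following holds. 1. For a.e. $t$, $F(t,\cdot,\cdot)$ is the restriction to $X\times V$ of a map $X\times H\to W$ that is continuous with respect to weak convergence of sequences in $X\times H$ and in $W$. 2. The embedding $V\hookrightarrow H$ is compact, there is a continuous embedding $H\hookrightarrow W^*$, and for a.e. $t$ the following holds for all sequences $(\lambda_k)$ in $X$, $(u_k)$ in $V$ and all $\lambda\in X$, $u\in V$: if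 $u_k\rightharpoonup u$ in $H$, $\lambda_k\rightharpoonup\lambda$ in $X$ and $\liminf_k\langle F(t,\lambda_k,u_k),u_k-u\rangle_{W,W^*}\ge0$, then $\langle F(t,\lambda,u),u-v\rangle_{W,W^*}\ge\limsup_k\langle F(t,\lambda_k,u_k),u_k-v\rangle_{W,W^*}$ for all $v\in W^*$. **Regularizers.** Let $\mathcal R_1:X\times\mathbb R^m\times U_0\times\mathcal V\to[0,\infty]$ and $\mathcal R_2:\Theta\to[0,\infty]$ be weakly (sequentially) lower semicontinuous with $\mathcal R_2\not\equiv\infty$. Assume that for every $c\in[0,\infty)$ the sublevel set $\{\mathcal R_1(\lambda,\alpha,u_0,u)+\mathcal R_2(\theta)\le c\}$ is weakly precompact in $X\times\mathbb R^m\times U_0\times\mathcal V\times\Theta$, i.e. each of its sequences has a subsequence that converges weakly in the whole space. **Proposition (Existence).** For every $K\ge1$ and all data $y^1,\dots,y^K\in\mathcal Y$, the learning problem $$\min_{(\lambda^k,\alpha^k,u_0^k,u^k)_{k=1}^K,\;\theta}\ \sum_{k=1}^K\Big(\|\mathcal G(\lambda^k,\alpha^k,u_0^k,u^k,\theta)-(0,0,y^k)\|^2+\mathcal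 R_1(\lambda^k,\alpha^k,u_0^k,u^k)\Big)+\mathcal R_2(\theta)$$ over $(X\times\mathbb R^m\times U_0\times\mathcal V)^K\times\Theta$ has a minimizer. For every $y\in\mathcal Y$ and every fixed $\hat\theta\in\Theta$, the learning-informed parameter identification problem $$\min_{(\lambda,\alpha,u_0,u)}\ \|\mathcal G(\lambda,\alpha,u_0,u,\hat\theta)-(0,0,y)\|^2+\mathcal R_1(\lambda,\alpha,u_0,u)$$ over $X\times\mathbb R^m\times U_0\times\mathcal V$ has a minimizer. -/

import Mathlib

open MeasureTheory Filter Topology Set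
open scoped ENNReal NNReal ContDiff

namespace LearnPDE

noncomputable section

/-! ### Weak convergence and reflexivity -/

section Weak

variable {E F : Type*} [NormedAddCommGroup E] [NormedSpace ℝ E]
  [NormedAddCommGroup F] [NormedSpace ℝ F]

/-- Weak convergence `x n ⇀ a` of a sequence in a normed space: convergence against every
bounded linear functional. -/
def WeakConv (x : ℕ → E) (a : E) : Prop :=
  ∀ f : StrongDual ℝ E, Tendsto (fun n => f (x n)) atTop (𝓝 (f a))

/-- Weak precompactness: every sequence in `S` has a subsequence that converges weakly
(the limit need not belong to `S`). -/
def WeaklyPrecompact (S : Set E) : Prop :=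
  ∀ x : ℕ → E, (∀ n, x n ∈ S) →
    ∃ (a : E) (φ : ℕ → ℕ), StrictMono φ ∧ WeakConv (fun n => x (φ n)) a

/-- Weak lower semicontinuity of an extended-valued functional. -/
def WeaklyLSC (R : E → ℝ≥0∞) : Prop :=
  ∀ (x : ℕ → E) (a : E), WeakConv x a → R a ≤ liminf (fun n => R (x n)) atTop

/-- Weak(-to-weak) continuity of a map between normed spaces. -/
def WeaklyContinuous (g : E → F) : Prop :=
  ∀ (x : ℕ → E) (a : E), WeakConv x a → WeakConv (fun n => g (x n)) (g a)

variable (E) in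
/-- Reflexivity: the canonical map into the bidual is onto. -/
def IsReflexive : Prop :=
  Function.Surjective (NormedSpace.inclusionInDoubleDual ℝ E)

end Weak

/-! ### Bochner spaces on the time interval and the state space -/

/-- Lebesgue measure on the time interval `(0,T)`. -/
abbrev timeMeasure (T : ℝ) : Measure ℝ := volume.restrict (Ioo 0 T)

/-- The Bochner space `L²(0,T;E)`. -/
abbrev BochnerL2 (T : ℝ) (E : Type*) [NormedAddCommGroup E] : Type _ :=
  Lp E 2 (timeMeasure T)

/-- The Lebesgue space `L^p(Ω)` of real functions. -/
abbrev SpaceLp {d : ℕ} (Ω : Set (EuclideanSpace ℝ (Fin d))) (p : ℝ≥0∞) : Type _ :=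
  Lp ℝ p (volume.restrict Ω)

/-- The space `L^∞((0,T) × Ω)`. -/
abbrev SpaceTimeLinfty {d : ℕ} (Ω : Set (EuclideanSpace ℝ (Fin d))) (T : ℝ) : Type _ :=
  Lp ℝ ⊤ ((timeMeasure T).prod (volume.restrict Ω))

/-- `u'` is the weak time derivative of `u` on `(0,T)`. -/
def HasWeakDeriv {E : Type*} [NormedAddCommGroup E] [NormedSpace ℝ E]
    (T : ℝ) (u u' : ℝ → E) : Prop :=
  ∀ φ : ℝ → ℝ, ContDiff ℝ ∞ φ → HasCompactSupport φ → tsupport φ ⊆ Ioo 0 T →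
    ∫ t in Ioo 0 T, deriv φ t • u t = - ∫ t in Ioo 0 T, φ t • u' t

section StateSpace

variable {V Vt : Type*} [NormedAddCommGroup V] [NormedSpace ℝ V]
  [NormedAddCommGroup Vt] [NormedSpace ℝ Vt]

lemma integrable_test_smul {E : Type*} [NormedAddCommGroup E] [NormedSpace ℝ E] {T : ℝ}
    {φ : ℝ → ℝ} (hφ : Continuous φ) (hc : HasCompactSupport φ) {u : ℝ → E}
    (hu : MemLp u 2 (timeMeasure T)) : Integrable (fun t => φ t • u t) (timeMeasure T) := by
  obtain ⟨C, hC⟩ := hc.exists_bound_of_continuous hφ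
  exact (hu.integrable one_le_two).bdd_smul C hφ.aestronglyMeasurable (ae_of_all _ hC)

/-- The state space `L²(0,T;V) ∩ H¹(0,T;Vt)`, where `V` is embedded into `Vt` by `ι`: its
elements are the pairs `(u, u')` of `u ∈ L²(0,T;V)` and its weak time derivative
`u' ∈ L²(0,T;Vt)` (which is determined by `u`), with the norm
`(∫ ‖u t‖² + ‖u' t‖² dt)^(1/2)`. -/
def stateSpace (T : ℝ) (ι : V →L[ℝ] Vt) :
    Submodule ℝ (WithLp 2 (BochnerL2 T V × BochnerL2 T Vt)) where
  carrier := {u | HasWeakDeriv T (fun t => ι (u.fst t)) (fun t => u.snd t)}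
  zero_mem' := by
    intro φ _ _ _
    have h1 : ∀ᵐ t ∂(timeMeasure T), (0 : BochnerL2 T V) t = 0 := Lp.coeFn_zero V 2 _
    have h2 : ∀ᵐ t ∂(timeMeasure T), (0 : BochnerL2 T Vt) t = 0 := Lp.coeFn_zero Vt 2 _
    have e1 : ∫ t in Ioo 0 T, deriv φ t • ι ((0 : BochnerL2 T V) t) = 0 := by
      rw [← integral_zero ℝ Vt (μ := timeMeasure T)]
      exact integral_congr_ae (by
        filter_upwards [h1] with t ht
        rw [ht, map_zero, smul_zero])
    have e2 : ∫ t in Ioo 0 T, φ t • ((0 : BochnerL2 T Vt) t) = 0 := by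
      rw [← integral_zero ℝ Vt (μ := timeMeasure T)]
      exact integral_congr_ae (by
        filter_upwards [h2] with t ht
        rw [ht, smul_zero])
    exact e1.trans (by rw [← neg_zero, ← e2]; rfl)
  add_mem' := by
    intro a b ha hb φ h1 h2 h3
    have hd : Continuous (deriv φ) := h1.continuous_deriv (by simp)
    have i1 := integrable_test_smul hd h2.deriv (u := fun t => ι (a.fst t))
      (ι.comp_memLp' (Lp.memLp a.fst))
    have i2 := integrable_test_smul hd h2.deriv (u := fun t => ι (b.fst t))
      (ι.comp_memLp' (Lp.memLp b.fst))
    have i3 := integrable_test_smul h1.continuous h2 (Lp.memLp a.snd)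
    have i4 := integrable_test_smul h1.continuous h2 (Lp.memLp b.snd)
    have e1 : ∫ t in Ioo 0 T, deriv φ t • ι ((a + b).fst t)
        = ∫ t in Ioo 0 T, (deriv φ t • ι (a.fst t) + deriv φ t • ι (b.fst t)) := by
      refine integral_congr_ae ?_
      filter_upwards [Lp.coeFn_add a.fst b.fst] with t ht
      simp only [WithLp.add_fst, ht, Pi.add_apply, map_add, smul_add]
    have e2 : ∫ t in Ioo 0 T, φ t • ((a + b).snd t)
        = ∫ t in Ioo 0 T, (φ t • (a.snd t) + φ t • (b.snd t)) := by
      refine integral_congr_ae ?_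
      filter_upwards [Lp.coeFn_add a.snd b.snd] with t ht
      simp only [WithLp.add_snd, ht, Pi.add_apply, smul_add]
    rw [e1, e2, integral_add i1 i2, integral_add i3 i4, ha φ h1 h2 h3, hb φ h1 h2 h3]
    abel
  smul_mem' := by
    intro c a ha φ h1 h2 h3
    have e1 : ∫ t in Ioo 0 T, deriv φ t • ι ((c • a).fst t)
        = ∫ t in Ioo 0 T, c • (deriv φ t • ι (a.fst t)) := by
      refine integral_congr_ae ?_
      filter_upwards [Lp.coeFn_smul c a.fst] with t ht
      simp only [WithLp.smul_fst, ht, Pi.smul_apply, map_smul]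
      rw [smul_comm]
    have e2 : ∫ t in Ioo 0 T, φ t • ((c • a).snd t)
        = ∫ t in Ioo 0 T, c • (φ t • (a.snd t)) := by
      refine integral_congr_ae ?_
      filter_upwards [Lp.coeFn_smul c a.snd] with t ht
      simp only [WithLp.smul_snd, ht, Pi.smul_apply]
      rw [smul_comm]
    rw [e1, e2, integral_smul, integral_smul, ha φ h1 h2 h3, smul_neg]

end StateSpace

/-! ### Feed-forward neural networks -/

/-- An architecture `(n_0, …, n_L)` of a network `ℝ^m × ℝ → ℝ` of depth `L`; only the values
`width 0, …, width depth` matter. -/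
structure Architecture (m : ℕ) where
  depth : ℕ
  depth_pos : 1 ≤ depth
  width : ℕ → ℕ
  width_zero : width 0 = m + 1
  width_depth : width depth = 1

namespace Architecture

variable {m : ℕ} (A : Architecture m)

/-- The parameter space `Θ`: a weight `ω` and a bias `β` for every layer. -/
abbrev Params : Type :=
  ∀ l : Fin A.depth,
    (EuclideanSpace ℝ (Fin (A.width l)) →L[ℝ] EuclideanSpace ℝ (Fin (A.width (l + 1)))) ×
      EuclideanSpace ℝ (Fin (A.width (l + 1)))

/-- One layer: `z ↦ σ (ω z + β)`, with `σ` applied to every coordinate; the last layer is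
`z ↦ ω z + β`. -/
def layer (σ : ℝ → ℝ) (θ : A.Params) (l : Fin A.depth) (z : EuclideanSpace ℝ (Fin (A.width l))) :
    EuclideanSpace ℝ (Fin (A.width (l + 1))) :=
  if (l : ℕ) + 1 = A.depth then (θ l).1 z + (θ l).2
  else WithLp.toLp 2 (fun i => σ (((θ l).1 z + (θ l).2) i))

/-- The composition of the first `l` layers. -/
def layers (σ : ℝ → ℝ) (θ : A.Params) : (l : ℕ) → l ≤ A.depth →
    EuclideanSpace ℝ (Fin (A.width 0)) → EuclideanSpace ℝ (Fin (A.width l))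
  | 0, _, z => z
  | l + 1, h, z => A.layer σ θ ⟨l, h⟩ (layers σ θ l (Nat.le_of_succ_le h) z)

/-- The input vector `(α, y) ∈ ℝ^(m+1)`. -/
def input (α : EuclideanSpace ℝ (Fin m)) (y : ℝ) : EuclideanSpace ℝ (Fin (A.width 0)) :=
  WithLp.toLp 2 (fun i =>
    Fin.snoc (α := fun _ => ℝ) (fun j => α j) y (Fin.cast A.width_zero i))

/-- The network `𝒩_θ : ℝ^m × ℝ → ℝ` with activation function `σ`. -/
def net (σ : ℝ → ℝ) (θ : A.Params) (α : EuclideanSpace ℝ (Fin m)) (y : ℝ) : ℝ :=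
  A.layers σ θ A.depth le_rfl (A.input α y) (Fin.cast A.width_depth.symm 0)

lemma continuous_layer {σ : ℝ → ℝ} (hσ : Continuous σ) (θ : A.Params) (l : Fin A.depth) :
    Continuous (A.layer σ θ l) := by
  unfold layer
  split_ifs
  · fun_prop
  · fun_prop

lemma continuous_layers {σ : ℝ → ℝ} (hσ : Continuous σ) (θ : A.Params) (l : ℕ)
    (h : l ≤ A.depth) : Continuous (A.layers σ θ l h) := by
  induction l with
  | zero => exact continuous_id
  | succ l ih => exact (A.continuous_layer hσ θ ⟨l, h⟩).comp (ih _)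

lemma continuous_net {σ : ℝ → ℝ} (hσ : Continuous σ) (θ : A.Params)
    (α : EuclideanSpace ℝ (Fin m)) : Continuous (A.net σ θ α) := by
  have h1 : Continuous (A.input α) := by
    refine (PiLp.continuous_toLp 2 _).comp (continuous_pi fun i => ?_)
    refine Fin.lastCases (motive := fun j => Continuous fun y : ℝ =>
      (Fin.snoc (α := fun _ => ℝ) (fun j => α j) y j : ℝ)) ?_ ?_ (Fin.cast A.width_zero i)
    · simpa using continuous_id'
    · intro j
      simpa using continuous_const
  have h2 := (A.continuous_layers hσ θ A.depth le_rfl).comp h1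
  exact (EuclideanSpace.proj (𝕜 := ℝ) (Fin.cast A.width_depth.symm 0)).continuous.comp h2

end Architecture

/-! ### The abstract evolution setting -/

/-- The spaces, embeddings and operators of the abstract evolution equation
`u' = F(t, λ, u) + 𝒩_θ(α, u)`, `u(0) = u₀`, with observations `y = M u`.

Every embedding is an injective bounded linear map, and different ways to embed one space
into another agree. -/
structure Setting {d : ℕ} (Ω : Set (EuclideanSpace ℝ (Fin d))) (T : ℝ) (p : ℝ≥0∞)
    [Fact (1 ≤ p)] (X V W Y Vt U₀ H : Type*)
    [NormedAddCommGroup X] [NormedSpace ℝ X] [NormedAddCommGroup V] [NormedSpace ℝ V]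
    [NormedAddCommGroup W] [NormedSpace ℝ W] [NormedAddCommGroup Y] [NormedSpace ℝ Y]
    [NormedAddCommGroup Vt] [NormedSpace ℝ Vt] [NormedAddCommGroup U₀] [NormedSpace ℝ U₀]
    [NormedAddCommGroup H] [NormedSpace ℝ H] where
  /-- The space domain is a bounded open set. -/
  isOpen_domain : IsOpen Ω
  isBounded_domain : Bornology.IsBounded Ω
  T_pos : 0 < T
  p_ne_top : p ≠ ⊤
  /- Reflexivity and separability of the spaces. -/
  X_reflexive : IsReflexive X
  V_reflexive : IsReflexive V
  W_reflexive : IsReflexive W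
  Y_reflexive : IsReflexive Y
  Vt_reflexive : IsReflexive Vt
  U₀_reflexive : IsReflexive U₀
  H_reflexive : IsReflexive H
  V_separable : TopologicalSpace.SeparableSpace V
  W_separable : TopologicalSpace.SeparableSpace W
  Y_separable : TopologicalSpace.SeparableSpace Y
  Vt_separable : TopologicalSpace.SeparableSpace Vt
  H_separable : TopologicalSpace.SeparableSpace H
  /-- `U₀ ↪ H` -/
  U₀_H : U₀ →L[ℝ] H
  U₀_H_injective : Function.Injective U₀_H
  /-- `H ↪ W` -/
  H_W : H →L[ℝ] W
  H_W_injective : Function.Injective H_W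
  /-- `V ↪ H` -/
  V_H : V →L[ℝ] H
  V_H_injective : Function.Injective V_H
  /-- `H ↪ Vt` -/
  H_Vt : H →L[ℝ] Vt
  H_Vt_injective : Function.Injective H_Vt
  /-- `V ↪ Y` -/
  V_Y : V →L[ℝ] Y
  V_Y_injective : Function.Injective V_Y
  /-- `V ↪ L^p(Ω)`, compactly -/
  V_Lp : V →L[ℝ] SpaceLp Ω p
  V_Lp_injective : Function.Injective V_Lp
  V_Lp_compact : IsCompactOperator V_Lp
  /-- `L^p(Ω) ↪ W` -/
  Lp_W : SpaceLp Ω p →L[ℝ] W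
  Lp_W_injective : Function.Injective Lp_W
  /-- `Vt ↪ W`, so that the time derivative of a state is an element of `L²(0,T;W)` -/
  Vt_W : Vt →L[ℝ] W
  Vt_W_injective : Function.Injective Vt_W
  V_Lp_W : ∀ v, Lp_W (V_Lp v) = H_W (V_H v)
  H_Vt_W : ∀ h, Vt_W (H_Vt h) = H_W h
  /-- `L^p(Ω) ↪ Vt` or `Vt ↪ L^p(Ω)` -/
  Lp_Vt_or_Vt_Lp :
    (∃ j : SpaceLp Ω p →L[ℝ] Vt, Function.Injective j ∧
      (∀ v, j (V_Lp v) = H_Vt (V_H v)) ∧ ∀ f, Vt_W (j f) = Lp_W f) ∨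
    (∃ j : Vt →L[ℝ] SpaceLp Ω p, Function.Injective j ∧
      (∀ v, j (H_Vt (V_H v)) = V_Lp v) ∧ ∀ w, Lp_W (j w) = Vt_W w)
  /-- The embedding of the state space into `L^∞((0,T) × Ω)`. -/
  toLinfty : stateSpace T (H_Vt ∘L V_H) →L[ℝ] SpaceTimeLinfty Ω T
  toLinfty_spec : ∀ u : stateSpace T (H_Vt ∘L V_H), ∀ᵐ t ∂(timeMeasure T),
    ∀ᵐ x ∂(volume.restrict Ω), toLinfty u (t, x) = V_Lp (u.1.fst t) x
  /-- The embedding of the state space into `C([0,T];H)`. -/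
  toC : stateSpace T (H_Vt ∘L V_H) →L[ℝ] C(Icc (0 : ℝ) T, H)
  toC_spec : ∀ u : stateSpace T (H_Vt ∘L V_H), ∀ᵐ t ∂(timeMeasure T),
    ∀ ht : t ∈ Icc (0 : ℝ) T, toC u ⟨t, ht⟩ = V_H (u.1.fst t)
  /-- The observation operator. -/
  M : stateSpace T (H_Vt ∘L V_H) →L[ℝ] BochnerL2 T Y
  /-- The known part of the model; only its values for `t ∈ (0,T)` matter. -/
  F : ℝ → X → V → W
  /- The Carathéodory conditions. -/
  F_measurable : ∀ (lam : X) (v : V), AEStronglyMeasurable (fun t => F t lam v) (timeMeasure T)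
  F_continuous : ∀ lam : X, ∀ᵐ t ∂(timeMeasure T), Continuous (F t lam)
  /- The growth condition. -/
  F_growth : ∃ (B : ℝ → ℝ → ℝ) (γ : ℝ → ℝ), (∀ a, Monotone (B a)) ∧
    MemLp γ 2 (timeMeasure T) ∧ ∀ᵐ t ∂(timeMeasure T), ∀ (lam : X) (v : V),
      ‖F t lam v‖ ≤ B ‖lam‖ ‖V_H v‖ * (γ t + ‖v‖)

/-! ### Measurability of superposition operators -/

lemma measurable_of_edist {α E : Type*} [MeasurableSpace α] [PseudoEMetricSpace E]
    [SecondCountableTopology E] [MeasurableSpace E] [BorelSpace E] {f : α → E}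
    (h : ∀ e, Measurable fun a => edist (f a) e) : Measurable f := by
  refine measurable_of_isOpen fun U hU => ?_
  have h1 : ∀ x : U, ∃ r > 0, Metric.eball (x : E) r ⊆ U := fun x => EMetric.isOpen_iff.1 hU x x.2
  choose r hr hrU using h1
  obtain ⟨S, hS, hSU⟩ := TopologicalSpace.isOpen_iUnion_countable
    (fun x : U => Metric.eball (x : E) (r x)) (fun x => Metric.isOpen_eball)
  have h2 : U = ⋃ x ∈ S, Metric.eball (x : E) (r x) := by
    rw [hSU]
    refine Subset.antisymm (fun x hx => mem_iUnion.2 ⟨⟨x, hx⟩, ?_⟩) (iUnion_subset hrU)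
    exact Metric.mem_eball_self (hr _)
  rw [h2, preimage_iUnion₂]
  exact MeasurableSet.biUnion hS fun x _ => measurableSet_lt (h x) measurable_const

section Superposition

variable {d : ℕ} {Ω : Set (EuclideanSpace ℝ (Fin d))} {T : ℝ} {p : ℝ≥0∞} [Fact (1 ≤ p)]

open Classical in
/-- The map `t ↦ g (t, ·)` as a map into `L^p(Ω)`, for `g` with sections in `L^p(Ω)` for
almost every `t`. -/
def sections (Ω : Set (EuclideanSpace ℝ (Fin d))) (p : ℝ≥0∞)
    (g : ℝ × EuclideanSpace ℝ (Fin d) → ℝ) (t : ℝ) : SpaceLp Ω p :=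
  if h : MemLp (fun x => g (t, x)) p (volume.restrict Ω) then h.toLp _ else 0

lemma measurable_eLpNorm_section (hp : p ≠ ⊤) {g : ℝ × EuclideanSpace ℝ (Fin d) → ℝ}
    (hg : Measurable g) :
    Measurable fun t => eLpNorm (fun x => g (t, x)) p (volume.restrict Ω) := by
  have hp0 : p ≠ 0 := (zero_lt_one.trans_le (Fact.out : 1 ≤ p)).ne'
  simp only [eLpNorm_eq_lintegral_rpow_enorm_toReal hp0 hp]
  exact (Measurable.lintegral_prod_right' (f := fun z => ‖g z‖ₑ ^ p.toReal)
    (hg.enorm.pow_const _)).pow_const _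

lemma aestronglyMeasurable_sections (hp : p ≠ ⊤) {g : ℝ × EuclideanSpace ℝ (Fin d) → ℝ}
    (hg : Measurable g) :
    AEStronglyMeasurable (sections Ω p g) (timeMeasure T) := by
  classical
  have : Fact (p ≠ ⊤) := ⟨hp⟩
  let _ : MeasurableSpace (SpaceLp Ω p) := borel _
  have : BorelSpace (SpaceLp Ω p) := ⟨rfl⟩
  have hm : ∀ t, Measurable fun x => g (t, x) := fun t => hg.comp measurable_prodMk_left
  have key : Measurable (sections Ω p g) := by
    refine measurable_of_edist fun e => ?_
    have hA : MeasurableSet {t | eLpNorm (fun x => g (t, x)) p (volume.restrict Ω) < ⊤} :=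
      measurableSet_lt (measurable_eLpNorm_section hp hg) measurable_const
    have heq : (fun t => edist (sections Ω p g t) e) = fun t =>
        if t ∈ {t | eLpNorm (fun x => g (t, x)) p (volume.restrict Ω) < ⊤} then
          eLpNorm (fun x => g (t, x) - e x) p (volume.restrict Ω) else edist 0 e := by
      funext t
      by_cases ht : eLpNorm (fun x => g (t, x)) p (volume.restrict Ω) < ⊤
      · have hML : MemLp (fun x => g (t, x)) p (volume.restrict Ω) :=
          ⟨(hm t).aestronglyMeasurable, ht⟩
        simp only [mem_ofPred_eq, if_pos ht]
        rw [sections, dif_pos hML, Lp.edist_def]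
        refine eLpNorm_congr_ae ?_
        filter_upwards [hML.coeFn_toLp] with x hx
        simp [hx]
      · have hML : ¬ MemLp (fun x => g (t, x)) p (volume.restrict Ω) := fun h => ht h.2
        simp only [mem_ofPred_eq, if_neg ht]
        rw [sections, dif_neg hML]
    rw [heq]
    refine Measurable.ite hA ?_ measurable_const
    exact measurable_eLpNorm_section (Ω := Ω) hp
      (g := fun z => g z - e z.2) (hg.sub ((Lp.stronglyMeasurable e).measurable.comp measurable_snd))
  exact key.aestronglyMeasurable

lemma memLp_section (hΩ : Bornology.IsBounded Ω)
    {g : ℝ × EuclideanSpace ℝ (Fin d) → ℝ} (hg : Measurable g) {C : ℝ}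
    (hC : ∀ᵐ z ∂((timeMeasure T).prod (volume.restrict Ω)), ‖g z‖ ≤ C) :
    ∀ᵐ t ∂(timeMeasure T), (∀ᵐ x ∂(volume.restrict Ω), ‖g (t, x)‖ ≤ C) ∧
      MemLp (fun x => g (t, x)) p (volume.restrict Ω) := by
  have : IsFiniteMeasure (volume.restrict Ω) :=
    ⟨by rw [Measure.restrict_apply_univ]; exact hΩ.measure_lt_top⟩
  filter_upwards [Measure.ae_ae_of_ae_prod hC] with t ht
  exact ⟨ht, MemLp.of_bound (hg.comp measurable_prodMk_left).aestronglyMeasurable C ht⟩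

lemma memLp_sections (hΩ : Bornology.IsBounded Ω) (hp : p ≠ ⊤)
    {g : ℝ × EuclideanSpace ℝ (Fin d) → ℝ} (hg : Measurable g) {C : ℝ}
    (hC : ∀ᵐ z ∂((timeMeasure T).prod (volume.restrict Ω)), ‖g z‖ ≤ C) :
    MemLp (sections Ω p g) 2 (timeMeasure T) := by
  have : IsFiniteMeasure (volume.restrict Ω) :=
    ⟨by rw [Measure.restrict_apply_univ]; exact hΩ.measure_lt_top⟩
  set K : ℝ := ‖Lp.const p (volume.restrict Ω) C‖ with hK
  refine MemLp.of_bound (aestronglyMeasurable_sections hp hg) K ?_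
  filter_upwards [memLp_section (p := p) hΩ hg hC] with t ht
  rw [sections, dif_pos ht.2]
  refine Lp.norm_le_norm_of_ae_le ?_
  filter_upwards [ht.1, ht.2.coeFn_toLp, Lp.coeFn_const p (volume.restrict Ω) C] with x h1 h2 h3
  rw [h2, h3]
  exact h1.trans (le_abs_self C)

end Superposition

/-! ### The forward operator and the two minimization problems -/

namespace Setting

variable {d : ℕ} {Ω : Set (EuclideanSpace ℝ (Fin d))} {T : ℝ} {p : ℝ≥0∞} [Fact (1 ≤ p)]
  {X V W Y Vt U₀ H : Type*}
  [NormedAddCommGroup X] [NormedSpace ℝ X] [NormedAddCommGroup V] [NormedSpace ℝ V]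
  [NormedAddCommGroup W] [NormedSpace ℝ W] [NormedAddCommGroup Y] [NormedSpace ℝ Y]
  [NormedAddCommGroup Vt] [NormedSpace ℝ Vt] [NormedAddCommGroup U₀] [NormedSpace ℝ U₀]
  [NormedAddCommGroup H] [NormedSpace ℝ H]
  (S : Setting Ω T p X V W Y Vt U₀ H)

/-- The state space `L²(0,T;V) ∩ H¹(0,T;Vt)`. -/
abbrev State : Type _ := stateSpace T (S.H_Vt ∘L S.V_H)

/-- The time derivative of a state, in `L²(0,T;W)`. -/
def timeDeriv (u : S.State) : BochnerL2 T W := S.Vt_W.compLp u.1.snd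

/-- The initial value `u(0) ∈ H` of a state. -/
def initial (u : S.State) : H := S.toC u ⟨0, left_mem_Icc.2 S.T_pos.le⟩

lemma memLp_F (lam : X) (u : S.State) :
    MemLp (fun t => S.F t lam (u.1.fst t)) 2 (timeMeasure T) := by
  have hmeas : AEStronglyMeasurable (fun t => S.F t lam (u.1.fst t)) (timeMeasure T) := by
    have hs := Lp.stronglyMeasurable u.1.fst
    refine aestronglyMeasurable_of_tendsto_ae atTop
      (f := fun n t => S.F t lam (hs.approx n t)) (fun n => ?_) ?_
    · have hsum : (fun t => S.F t lam (hs.approx n t)) = fun t =>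
          ∑ v ∈ (hs.approx n).range,
            ((hs.approx n) ⁻¹' {v}).indicator (fun t => S.F t lam v) t := by
        classical
        funext t
        rw [Finset.sum_eq_single (hs.approx n t)]
        · rw [indicator_of_mem (by simp)]
        · intro v _ hv
          rw [indicator_of_notMem]
          simpa using fun h => hv h.symm
        · intro h
          exact absurd (SimpleFunc.mem_range_self _ t) h
      rw [hsum]
      exact Finset.aestronglyMeasurable_fun_sum _ fun v _ =>
        (S.F_measurable lam v).indicator ((hs.approx n).measurableSet_fiber v)
    · filter_upwards [S.F_continuous lam] with t ht
      exact (ht.tendsto _).comp (hs.tendsto_approx t)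
  obtain ⟨B, γ, hB, hγ, hF⟩ := S.F_growth
  set K : ℝ := max |B ‖lam‖ 0| |B ‖lam‖ ‖S.toC u‖|
  have hdom : MemLp (fun t => |γ t| + ‖u.1.fst t‖) 2 (timeMeasure T) :=
    hγ.abs.add (Lp.memLp u.1.fst).norm
  refine hdom.of_le_mul (c := K) hmeas ?_
  filter_upwards [hF, S.toC_spec u, ae_restrict_mem measurableSet_Ioo] with t h1 h2 h3
  have h4 : ‖S.V_H (u.1.fst t)‖ ≤ ‖S.toC u‖ := by
    rw [← h2 (Ioo_subset_Icc_self h3)]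
    exact ContinuousMap.norm_coe_le_norm _ _
  have h5 : |B ‖lam‖ ‖S.V_H (u.1.fst t)‖| ≤ K :=
    abs_le_max_abs_abs (hB _ (norm_nonneg _)) (hB _ h4)
  have h6 : |γ t + ‖u.1.fst t‖| ≤ |γ t| + ‖u.1.fst t‖ := by
    simpa using abs_add_le (γ t) ‖u.1.fst t‖
  calc ‖S.F t lam (u.1.fst t)‖
      ≤ B ‖lam‖ ‖S.V_H (u.1.fst t)‖ * (γ t + ‖u.1.fst t‖) := h1 lam _
    _ ≤ |B ‖lam‖ ‖S.V_H (u.1.fst t)‖| * |γ t + ‖u.1.fst t‖| := by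
        rw [← abs_mul]; exact le_abs_self _
    _ ≤ K * (|γ t| + ‖u.1.fst t‖) :=
        mul_le_mul h5 h6 (abs_nonneg _) ((abs_nonneg _).trans h5)
    _ ≤ K * ‖|γ t| + ‖u.1.fst t‖‖ := by
        rw [Real.norm_of_nonneg (by positivity)]

/-- The Nemytskii operator `F(λ,u)(t) = F(t,λ,u(t))` with values in `L²(0,T;W)`. -/
def nemF (lam : X) (u : S.State) : BochnerL2 T W := (S.memLp_F lam u).toLp _

section Network

variable {m : ℕ} (A : Architecture m) {σ : ℝ → ℝ}

lemma exists_bound_net (hσ : Continuous σ) (α : EuclideanSpace ℝ (Fin m)) (u : S.State)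
    (θ : A.Params) :
    ∃ C : ℝ, ∀ᵐ z ∂((timeMeasure T).prod (volume.restrict Ω)),
      ‖A.net σ θ α (S.toLinfty u z)‖ ≤ C := by
  obtain ⟨C, hC⟩ := (isCompact_Icc (a := -‖S.toLinfty u‖) (b := ‖S.toLinfty u‖)
    ).exists_bound_of_continuousOn (A.continuous_net hσ θ α).continuousOn
  refine ⟨C, ?_⟩
  have h := ae_le_eLpNormEssSup (f := S.toLinfty u)
    (μ := (timeMeasure T).prod (volume.restrict Ω))
  filter_upwards [h] with z hz
  refine hC _ (abs_le.1 ?_)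
  rw [Lp.norm_def, eLpNorm_exponent_top, ← Real.norm_eq_abs, ← toReal_enorm]
  refine ENNReal.toReal_mono ?_ hz
  rw [← eLpNorm_exponent_top]
  exact Lp.eLpNorm_ne_top _

lemma measurable_net (hσ : Continuous σ) (α : EuclideanSpace ℝ (Fin m)) (u : S.State)
    (θ : A.Params) : Measurable fun z => A.net σ θ α (S.toLinfty u z) :=
  (A.continuous_net hσ θ α).measurable.comp (Lp.stronglyMeasurable (S.toLinfty u)).measurable

lemma memLp_net (hσ : Continuous σ) (α : EuclideanSpace ℝ (Fin m)) (u : S.State)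
    (θ : A.Params) :
    MemLp (sections Ω p fun z => A.net σ θ α (S.toLinfty u z)) 2 (timeMeasure T) := by
  obtain ⟨C, hC⟩ := S.exists_bound_net A hσ α u θ
  exact memLp_sections S.isBounded_domain S.p_ne_top (S.measurable_net A hσ α u θ) hC

/-- The Nemytskii operator `𝒩_θ(α,u)(t)(x) = 𝒩_θ(α, u(t,x))` with values in
`L²(0,T;L^p(Ω))`, where `u` is regarded as an element of `L^∞((0,T) × Ω)`. -/
def nemN (hσ : Continuous σ) (α : EuclideanSpace ℝ (Fin m)) (u : S.State) (θ : A.Params) :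
    BochnerL2 T (SpaceLp Ω p) := (S.memLp_net A hσ α u θ).toLp _

/-- The defining property of the Nemytskii operator of the network. -/
lemma nemN_spec (hσ : Continuous σ) (α : EuclideanSpace ℝ (Fin m)) (u : S.State)
    (θ : A.Params) : ∀ᵐ t ∂(timeMeasure T), ∀ᵐ x ∂(volume.restrict Ω),
      S.nemN A hσ α u θ t x = A.net σ θ α (S.toLinfty u (t, x)) := by
  obtain ⟨C, hC⟩ := S.exists_bound_net A hσ α u θ
  filter_upwards [(S.memLp_net A hσ α u θ).coeFn_toLp, memLp_section (p := p)
    S.isBounded_domain (S.measurable_net A hσ α u θ) hC] with t h1 h2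
  rw [nemN, h1, sections, dif_pos h2.2]
  exact h2.2.coeFn_toLp

/-- The unknowns `(λ, α, u₀, u)` of one experiment. -/
abbrev Unknowns (S : Setting Ω T p X V W Y Vt U₀ H) (m : ℕ) : Type _ :=
  X × EuclideanSpace ℝ (Fin m) × U₀ × S.State

/-- The image space `L²(0,T;W) × H × L²(0,T;Y)` of the forward operator, with the product
norm whose square is the sum of the squares of the three norms. -/
abbrev Image (T : ℝ) (W H Y : Type*) [NormedAddCommGroup W] [NormedAddCommGroup H]
    [NormedAddCommGroup Y] : Type _ :=
  WithLp 2 (BochnerL2 T W × WithLp 2 (H × BochnerL2 T Y))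

/-- The forward operator
`G(λ,α,u₀,u,θ) = (u' - F(λ,u) - 𝒩_θ(α,u), u(0) - u₀, M u)`. -/
def forward (hσ : Continuous σ) (x : S.Unknowns m) (θ : A.Params) : Image T W H Y :=
  match x with
  | (lam, α, u₀, u) =>
    WithLp.toLp 2
      (S.timeDeriv u - S.nemF lam u - S.Lp_W.compLp (S.nemN A hσ α u θ),
        WithLp.toLp 2 (S.initial u - S.U₀_H u₀, S.M u))

/-- The target `(0, 0, y)` for given data `y`. -/
def target (y : BochnerL2 T Y) : Image T W H Y := WithLp.toLp 2 (0, WithLp.toLp 2 (0, y))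

/-- The objective of the all-at-once learning problem with data `y^1, …, y^K`:
`∑ₖ (‖G(λ^k,α^k,u₀^k,u^k,θ) - (0,0,y^k)‖² + R₁(λ^k,α^k,u₀^k,u^k)) + R₂(θ)`. -/
def learningObjective (hσ : Continuous σ) (R₁ : S.Unknowns m → ℝ≥0∞) (R₂ : A.Params → ℝ≥0∞)
    {K : ℕ} (y : Fin K → BochnerL2 T Y) (z : (Fin K → S.Unknowns m) × A.Params) : ℝ≥0∞ :=
  ∑ k, (‖S.forward A hσ (z.1 k) z.2 - target (y k)‖ₑ ^ 2 + R₁ (z.1 k)) + R₂ z.2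

/-- The objective of the learning-informed parameter identification problem with data `y` and
fixed network parameters `θ`. -/
def identificationObjective (hσ : Continuous σ) (R₁ : S.Unknowns m → ℝ≥0∞)
    (y : BochnerL2 T Y) (θ : A.Params) (x : S.Unknowns m) : ℝ≥0∞ :=
  ‖S.forward A hσ x θ - target y‖ₑ ^ 2 + R₁ x

end Network

/-! ### The two structural alternatives for the model -/

/-- First alternative: for almost every `t`, `F(t,·,·)` is the restriction to `X × V` of a
weakly continuous map `X × H → W`. -/
def WeaklyContinuousModel : Prop :=
  ∃ FH : ℝ → X × H → W, ∀ᵐ t ∂(timeMeasure T),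
    (∀ (lam : X) (v : V), FH t (lam, S.V_H v) = S.F t lam v) ∧ WeaklyContinuous (FH t)

/-- Second alternative: `V` embeds compactly into `H`, there is an embedding `j` of `H` into the
dual of `W`, and `-F` is pseudomonotone with respect to the resulting pairing of `W` and `V`. -/
def PseudomonotoneModel : Prop :=
  IsCompactOperator S.V_H ∧
  ∃ j : H →L[ℝ] StrongDual ℝ W, Function.Injective j ∧
    ∀ᵐ t ∂(timeMeasure T), ∀ (lams : ℕ → X) (lam : X) (us : ℕ → V) (u : V),
      WeakConv (fun k => S.V_H (us k)) (S.V_H u) → WeakConv lams lam →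
      (0 : EReal) ≤ liminf (fun k =>
        ((j (S.V_H (us k) - S.V_H u) (S.F t (lams k) (us k)) : ℝ) : EReal)) atTop →
      ∀ w : StrongDual ℝ W,
        limsup (fun k =>
          (((j (S.V_H (us k)) - w) (S.F t (lams k) (us k)) : ℝ) : EReal)) atTop
        ≤ (((j (S.V_H u) - w) (S.F t lam u) : ℝ) : EReal)

end Setting

end

end LearnPDE

open LearnPDE

namespace LearnPDE

section WeakConvergence

variable {E F : Type*} [NormedAddCommGroup E] [NormedSpace ℝ E]
  [NormedAddCommGroup F] [NormedSpace ℝ F]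

namespace WeakConv

variable {x y : ℕ → E} {a b : E}

lemma map (h : WeakConv x a) (L : E →L[ℝ] F) : WeakConv (fun n => L (x n)) (L a) :=
  fun f => h (f ∘L L)

lemma subseq (h : WeakConv x a) {φ : ℕ → ℕ} (hφ : StrictMono φ) :
    WeakConv (fun n => x (φ n)) a :=
  fun f => (h f).comp hφ.tendsto_atTop

lemma sub (hx : WeakConv x a) (hy : WeakConv y b) : WeakConv (fun n => x n - y n) (a - b) :=
  fun f => by simpa using (hx f).sub (hy f)

lemma add (hx : WeakConv x a) (hy : WeakConv y b) : WeakConv (fun n => x n + y n) (a + b) :=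
  fun f => by simpa using (hx f).add (hy f)

lemma prodMk {y : ℕ → F} {b : F} (hx : WeakConv x a) (hy : WeakConv y b) :
    WeakConv (fun n => (x n, y n)) (a, b) := by
  simpa using (hx.map (ContinuousLinearMap.inl ℝ E F)).add (hy.map (ContinuousLinearMap.inr ℝ E F))

lemma of_tendsto (h : Tendsto x atTop (𝓝 a)) : WeakConv x a :=
  fun f => (f.continuous.tendsto a).comp h

lemma const (a : E) : WeakConv (fun _ => a) a := of_tendsto tendsto_const_nhds

lemma exists_norm_le (h : WeakConv x a) : ∃ C, ∀ n, ‖x n‖ ≤ C := by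
  obtain ⟨C, hC⟩ := banach_steinhaus (g := fun n => NormedSpace.inclusionInDoubleDual ℝ E (x n))
    fun f => by
      obtain ⟨C, hC⟩ := (h f).norm.bddAbove_range
      exact ⟨C, fun n => hC ⟨n, rfl⟩⟩
  refine ⟨C, fun n => ?_⟩
  have := (NormedSpace.inclusionInDoubleDualLi ℝ (E := E)).norm_map (x n)
  exact this ▸ hC n

lemma enorm_le_liminf (h : WeakConv x a) : ‖a‖ₑ ≤ liminf (fun n => ‖x n‖ₑ) atTop := by
  obtain ⟨f, hf, hfa⟩ := exists_dual_vector'' ℝ a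
  have h1 : Tendsto (fun n => ‖f (x n)‖ₑ) atTop (𝓝 ‖f a‖ₑ) := (h f).enorm
  have h2 : ‖f a‖ₑ = ‖a‖ₑ := by rw [hfa]; simp
  rw [← h2, ← h1.liminf_eq]
  refine liminf_le_liminf (Eventually.of_forall fun n => ?_)
  rw [← ofReal_norm, ← ofReal_norm]
  exact ENNReal.ofReal_le_ofReal ((f.le_of_opNorm_le hf _).trans_eq (one_mul _))

lemma tendsto [FiniteDimensional ℝ E] (h : WeakConv x a) : Tendsto x atTop (𝓝 a) := by
  let e := (Module.finBasis ℝ E).equivFunL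
  have h1 : Tendsto (fun n => e (x n)) atTop (𝓝 (e a)) :=
    tendsto_pi_nhds.2 fun i => h ((ContinuousLinearMap.proj (R := ℝ) (φ := fun _ => ℝ) i) ∘L
      e.toContinuousLinearMap)
  simpa [Function.comp_def] using (e.symm.continuous.tendsto _).comp h1

/-- Mazur's lemma: a weak limit is a norm limit of convex combinations of the tails. The same
convex combinations of a second sequence are recorded as well. -/
lemma exists_mem_convexHull (h : WeakConv x a) (y : ℕ → E) (k : ℕ) {ε : ℝ} (hε : 0 < ε) :
    ∃ b c, ‖b - a‖ < ε ∧ c ∈ convexHull ℝ (y '' Ici k) ∧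
      b + c ∈ convexHull ℝ ((fun n => x n + y n) '' Ici k) := by
  have key : a ∈ closure (convexHull ℝ (x '' Ici k)) := by
    by_contra hc
    obtain ⟨f, u, hu, hfa⟩ := geometric_hahn_banach_closed_point
      (convex_convexHull ℝ (x '' Ici k)).closure isClosed_closure hc
    have h1 : f a ≤ u := le_of_tendsto (h f) <| by
      filter_upwards [eventually_ge_atTop k] with n hn
      exact (hu _ (subset_closure (subset_convexHull ℝ _ ⟨n, hn, rfl⟩))).le
    linarith
  obtain ⟨b, hb, hd⟩ := Metric.mem_closure_iff.1 key ε hε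
  have h1 (L : E × E →ₗ[ℝ] E) : L '' convexHull ℝ ((fun n => (x n, y n)) '' Ici k) =
      convexHull ℝ ((fun n => L (x n, y n)) '' Ici k) := by
    rw [L.image_convexHull, image_image]
  obtain ⟨⟨b', c⟩, hq, rfl⟩ := (h1 (LinearMap.fst ℝ E E)).symm.subset hb
  refine ⟨b', c, ?_, (h1 (LinearMap.snd ℝ E E)).subset ⟨_, hq, rfl⟩,
    (h1 (LinearMap.fst ℝ E E + LinearMap.snd ℝ E E)).subset ⟨_, hq, rfl⟩⟩
  rwa [← dist_eq_norm, dist_comm]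

lemma of_mem_convexHull (h : WeakConv x a) (hy : ∀ k, y k ∈ convexHull ℝ (x '' Ici k)) :
    WeakConv y a := by
  intro f
  rw [Metric.tendsto_atTop]
  intro ε hε
  obtain ⟨N, hN⟩ := Metric.tendsto_atTop.1 (h f) ε hε
  refine ⟨N, fun k hk => ?_⟩
  have hc : Convex ℝ (f ⁻¹' Metric.ball (f a) ε) :=
    (convex_ball (f a) ε).linear_preimage f.toLinearMap
  refine convexHull_min ?_ hc (hy k)
  rintro _ ⟨n, hn, rfl⟩
  exact hN n (hk.trans hn)

end WeakConv

/-- An Ehrling type inequality for a compact operator, with finitely many functionals in place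
of a weaker norm. -/
lemma exists_ehrling {V G : Type*} [NormedAddCommGroup V] [NormedSpace ℝ V]
    [NormedAddCommGroup G] [NormedSpace ℝ G] (P : V →L[ℝ] E) (hP : IsCompactOperator P)
    (J : E →L[ℝ] G) (hJ : Function.Injective J) {ε : ℝ} (hε : 0 < ε) :
    ∃ s : Finset (StrongDual ℝ G), ∀ v, ‖P v‖ ≤ ε * ‖v‖ + ∑ g ∈ s, |g (J (P v))| := by
  classical
  set c : Set E := closure (P '' Metric.closedBall 0 1) ∩ {e | ε ≤ ‖e‖}
  have hc : IsCompact c := by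
    refine (hP.isCompact_closure_image_closedBall 1).inter_right ?_
    exact isClosed_le continuous_const continuous_norm
  have h1 : ∀ e ∈ c, ∃ g : StrongDual ℝ G, ‖P‖ < g (J e) := by
    intro e he
    have he0 : J e ≠ 0 := by
      intro h0
      have : e = 0 := hJ (h0.trans J.map_zero.symm)
      have h2 : ε ≤ ‖e‖ := he.2
      rw [this, norm_zero] at h2
      exact absurd hε h2.not_gt
    obtain ⟨f, -, hf⟩ := exists_dual_vector ℝ (J e) (norm_ne_zero_iff.2 he0)
    have hpos : 0 < ‖J e‖ := norm_pos_iff.2 he0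
    refine ⟨((‖P‖ + 1) / ‖J e‖) • f, ?_⟩
    have : f (J e) = ‖J e‖ := by simpa using hf
    rw [_root_.smul_apply, this, smul_eq_mul, div_mul_cancel₀ _ hpos.ne']
    exact lt_add_one _
  choose! g hg using h1
  obtain ⟨t, ht, htc⟩ := hc.elim_nhds_subcover (fun e => {e' | ‖P‖ < g e (J e')}) fun e he =>
    (isOpen_lt continuous_const ((g e).continuous.comp J.continuous)).mem_nhds (hg e he)
  refine ⟨t.image g, ?_⟩
  have h2 : ∀ v, ‖v‖ ≤ 1 → ‖P v‖ ≤ ε + ∑ g ∈ t.image g, |g (J (P v))| := by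
    intro v hv
    have hs : 0 ≤ ∑ g ∈ t.image g, |g (J (P v))| := Finset.sum_nonneg fun _ _ => abs_nonneg _
    by_cases hv2 : ε ≤ ‖P v‖
    · have hvc : P v ∈ c := ⟨subset_closure ⟨v, by simpa using hv, rfl⟩, hv2⟩
      obtain ⟨e, he, hev⟩ := mem_iUnion₂.1 (htc hvc)
      have h3 : |g e (J (P v))| ≤ ∑ g ∈ t.image g, |g (J (P v))| :=
        Finset.single_le_sum (f := fun g : StrongDual ℝ G => |g (J (P v))|)
          (fun _ _ => abs_nonneg _) (Finset.mem_image_of_mem g he)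
      have h4 : ‖P‖ < g e (J (P v)) := hev
      have h5 : ‖P v‖ ≤ ‖P‖ := P.unit_le_opNorm v hv
      linarith [le_abs_self (g e (J (P v)))]
    · linarith
  intro v
  rcases eq_or_ne v 0 with rfl | hv
  · simp
  have hpos : 0 < ‖v‖ := norm_pos_iff.2 hv
  have h3 := h2 (‖v‖⁻¹ • v) (by rw [norm_smul, norm_inv, norm_norm, inv_mul_cancel₀ hpos.ne'])
  simp only [map_smul, norm_smul, norm_inv, norm_norm, smul_eq_mul, abs_mul, abs_inv, abs_norm,
    ← Finset.mul_sum] at h3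
  have h4 := mul_le_mul_of_nonneg_left h3 hpos.le
  rw [mul_inv_cancel_left₀ hpos.ne', mul_add, mul_inv_cancel_left₀ hpos.ne'] at h4
  linarith

end WeakConvergence

section BochnerConvergence

variable {α : Type*} [MeasurableSpace α] {μ : Measure α}
  {G : Type*} [NormedAddCommGroup G] [NormedSpace ℝ G]

/-- The squared norm of `L²` is lower semicontinuous with respect to a sequence that converges
weakly almost everywhere. -/
lemma norm_le_of_weakConv_ae {g : ℕ → Lp G 2 μ} {a : Lp G 2 μ} {r : ℝ}
    (h : ∀ᵐ t ∂μ, WeakConv (fun n => g n t) (a t)) (hr : ∀ n, ‖g n‖ ≤ r) : ‖a‖ ≤ r := by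
  have hr0 : 0 ≤ r := (norm_nonneg _).trans (hr 0)
  have key : ∀ b : Lp G 2 μ, ∫⁻ t, ‖b t‖ₑ ^ (2 : ℝ) ∂μ = ‖b‖ₑ ^ (2 : ℝ) := by
    intro b
    rw [Lp.enorm_def, eLpNorm_eq_lintegral_rpow_enorm_toReal two_ne_zero ENNReal.ofNat_ne_top,
      ← ENNReal.rpow_mul]
    simp
  have h1 : ‖a‖ₑ ^ (2 : ℝ) ≤ ENNReal.ofReal r ^ (2 : ℝ) := by
    rw [← key]
    calc ∫⁻ t, ‖a t‖ₑ ^ (2 : ℝ) ∂μ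
        ≤ ∫⁻ t, liminf (fun n => ‖g n t‖ₑ ^ (2 : ℝ)) atTop ∂μ := by
          refine lintegral_mono_ae ?_
          filter_upwards [h] with t ht
          have := (ENNReal.orderIsoRpow 2 two_pos).liminf_apply (f := atTop)
            (u := fun n => ‖g n t‖ₑ)
          simp only [ENNReal.orderIsoRpow_apply] at this
          rw [← this]
          exact ENNReal.rpow_le_rpow ht.enorm_le_liminf zero_le_two
      _ ≤ liminf (fun n => ∫⁻ t, ‖g n t‖ₑ ^ (2 : ℝ) ∂μ) atTop :=
          lintegral_liminf_le' fun n =>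
            (Lp.aestronglyMeasurable (g n)).enorm.pow_const _
      _ ≤ ENNReal.ofReal r ^ (2 : ℝ) := by
          refine liminf_le_of_le (by isBoundedDefault) fun b hb => ?_
          obtain ⟨n, hn⟩ := hb.exists
          rw [key] at hn
          refine hn.trans (ENNReal.rpow_le_rpow ?_ zero_le_two)
          rw [← ofReal_norm]
          exact ENNReal.ofReal_le_ofReal (hr n)
  have h2 := (ENNReal.rpow_le_rpow_iff two_pos).1 h1
  rw [← ofReal_norm] at h2
  exact (ENNReal.ofReal_le_ofReal_iff hr0).1 h2

/-- Weak lower semicontinuity of the norm of `L²` for the sum of a weakly convergent sequence and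
a sequence that converges weakly almost everywhere. -/
lemma norm_add_le_of_weakConv_of_ae {a f : ℕ → Lp G 2 μ} {a' f' : Lp G 2 μ} {r : ℝ}
    (ha : WeakConv a a') (hf : ∀ᵐ t ∂μ, WeakConv (fun n => f n t) (f' t))
    (hr : ∀ n, ‖a n + f n‖ ≤ r) : ‖a' + f'‖ ≤ r := by
  have key : ∀ k : ℕ, ∃ b c : Lp G 2 μ, ‖b - a'‖ < 1 / ((k : ℝ) + 1) ∧ ‖b + c‖ ≤ r ∧
      ∀ᵐ t ∂μ, c t ∈ convexHull ℝ ((fun n => f n t) '' Ici k) := by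
    intro k
    obtain ⟨b, c, hb, hc, hbc⟩ := ha.exists_mem_convexHull f k (Nat.one_div_pos_of_nat (n := k))
    refine ⟨b, c, hb, ?_, ?_⟩
    · refine mem_closedBall_zero_iff.1 (convexHull_min ?_ (convex_closedBall _ r) hbc)
      rintro _ ⟨n, -, rfl⟩
      exact mem_closedBall_zero_iff.2 (hr n)
    · have hconv : Convex ℝ {q : Lp G 2 μ |
          ∀ᵐ t ∂μ, q t ∈ convexHull ℝ ((fun n => f n t) '' Ici k)} := by
        intro q hq q' hq' s s' hs hs' hss
        filter_upwards [hq, hq', Lp.coeFn_add (s • q) (s' • q'), Lp.coeFn_smul s q,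
          Lp.coeFn_smul s' q'] with t h1 h2 h3 h4 h5
        rw [h3, Pi.add_apply, h4, h5]
        exact convex_convexHull ℝ _ h1 h2 hs hs' hss
      refine convexHull_min ?_ hconv hc
      rintro _ ⟨n, hn, rfl⟩
      exact ae_of_all _ fun t => subset_convexHull ℝ _ ⟨n, hn, rfl⟩
  choose b c hb hr' hc using key
  have hb1 : Tendsto b atTop (𝓝 a') := by
    refine tendsto_iff_norm_sub_tendsto_zero.2 ?_
    exact squeeze_zero (fun _ => norm_nonneg _) (fun k => (hb k).le)
      tendsto_one_div_add_atTop_nhds_zero_nat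
  obtain ⟨φ, hφ, hbt⟩ := (tendstoInMeasure_of_tendsto_Lp hb1).exists_seq_tendsto_ae
  refine norm_le_of_weakConv_ae (g := fun k => b (φ k) + c (φ k)) ?_ fun k => hr' (φ k)
  have h1 : ∀ᵐ t ∂μ, ∀ k, (b (φ k) + c (φ k) : Lp G 2 μ) t = b (φ k) t + c (φ k) t :=
    ae_all_iff.2 fun k => Lp.coeFn_add _ _
  filter_upwards [h1, hbt, ae_all_iff.2 hc, hf, Lp.coeFn_add a' f'] with t h1 h2 h3 h4 h5
  simp only [h1]
  rw [h5, Pi.add_apply]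
  exact (WeakConv.of_tendsto h2).add ((h4.of_mem_convexHull h3).subseq hφ)

/-- A compact operator maps bounded sequences of `L²` which tend to zero weakly almost everywhere,
as elements of a larger space, to strong null sequences. -/
lemma tendsto_compLp_of_isCompactOperator [IsFiniteMeasure μ] {E V : Type*}
    [NormedAddCommGroup E] [NormedSpace ℝ E] [NormedAddCommGroup V] [NormedSpace ℝ V]
    (P : V →L[ℝ] E) (hP : IsCompactOperator P) (J : E →L[ℝ] G) (hJ : Function.Injective J)
    {v : ℕ → Lp V 2 μ} {C R : ℝ} (hC : ∀ n, ‖v n‖ ≤ C)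
    (hR : ∀ᵐ t ∂μ, ∀ n, ‖J (P (v n t))‖ ≤ R)
    (hv : ∀ᵐ t ∂μ, WeakConv (fun n => J (P (v n t))) 0) :
    Tendsto (fun n => P.compLp (v n)) atTop (𝓝 0) := by
  have hfun : ∀ g : StrongDual ℝ G, Tendsto
      (fun n => ((g ∘L J) ∘L P).compLp (v n)) atTop (𝓝 0) := by
    intro g
    have hm : ∀ n, AEStronglyMeasurable (fun t => g (J (P (v n t)))) μ := fun n =>
      ((g ∘L J) ∘L P).continuous.comp_aestronglyMeasurable (Lp.aestronglyMeasurable (v n))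
    rw [Lp.tendsto_Lp_iff_tendsto_eLpNorm']
    have h1 : ∀ n, eLpNorm (((((g ∘L J) ∘L P).compLp (v n) : Lp ℝ 2 μ) : α → ℝ)
        - ((0 : Lp ℝ 2 μ) : α → ℝ)) 2 μ = (∫⁻ t, ‖g (J (P (v n t)))‖ₑ ^ (2 : ℝ) ∂μ) ^ (1 / 2 : ℝ) := by
      intro n
      rw [eLpNorm_eq_lintegral_rpow_enorm_toReal two_ne_zero ENNReal.ofNat_ne_top]
      simp only [ENNReal.toReal_ofNat]
      congr 1
      refine lintegral_congr_ae ?_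
      filter_upwards [((g ∘L J) ∘L P).coeFn_compLp (v n), Lp.coeFn_zero ℝ 2 μ] with t h1 h2
      rw [Pi.sub_apply, h1, h2]
      simp
    simp only [h1]
    have h2 : Tendsto (fun n => ∫⁻ t, ‖g (J (P (v n t)))‖ₑ ^ (2 : ℝ) ∂μ) atTop
        (𝓝 (∫⁻ _, 0 ∂μ)) := by
      refine tendsto_lintegral_of_dominated_convergence'
        (fun _ => (ENNReal.ofReal (‖g‖ * R)) ^ (2 : ℝ)) (fun n => (hm n).enorm.pow_const _) ?_ ?_ ?_
      · intro n
        filter_upwards [hR] with t ht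
        refine ENNReal.rpow_le_rpow ?_ zero_le_two
        rw [← ofReal_norm]
        exact ENNReal.ofReal_le_ofReal (g.le_opNorm_of_le (ht n))
      · rw [lintegral_const]
        exact ENNReal.mul_ne_top (ENNReal.rpow_ne_top_of_nonneg zero_le_two ENNReal.ofReal_ne_top)
          (measure_ne_top _ _)
      · filter_upwards [hv] with t ht
        have h3 := (ht g).enorm
        rw [map_zero, enorm_zero] at h3
        have h4 := (ENNReal.continuous_rpow_const (y := 2)).tendsto (0 : ℝ≥0∞)
        rw [ENNReal.zero_rpow_of_pos two_pos] at h4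
        exact h4.comp h3
    have h5 := ((ENNReal.continuous_rpow_const (y := 1 / 2)).tendsto _).comp h2
    simpa [Function.comp_def] using h5
  rw [tendsto_zero_iff_norm_tendsto_zero, Metric.tendsto_atTop]
  intro ε hε
  have hC0 : 0 ≤ C := (norm_nonneg _).trans (hC 0)
  obtain ⟨s, hs⟩ := exists_ehrling P hP J hJ (show 0 < ε / (2 * (C + 1)) by positivity)
  have hsum : Tendsto (fun n => ∑ g ∈ s, ‖((g ∘L J) ∘L P).compLp (v n)‖) atTop (𝓝 0) := by
    have := tendsto_finsetSum s fun g _ => (hfun g).norm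
    simpa using this
  obtain ⟨N, hN⟩ := Metric.tendsto_atTop.1 hsum (ε / 2) (by positivity)
  refine ⟨N, fun n hn => ?_⟩
  have h1 : ‖P.compLp (v n)‖ ≤ ‖v n‖ * (ε / (2 * (C + 1)))
      + ∑ g ∈ s, ‖((g ∘L J) ∘L P).compLp (v n)‖ := by
    have hsumm : ∀ s : Finset (StrongDual ℝ G),
        eLpNorm (fun t => ∑ g ∈ s, |g (J (P (v n t)))|) 2 μ
          ≤ ∑ g ∈ s, ‖((g ∘L J) ∘L P).compLp (v n)‖ₑ := by
      intro s
      have h2 := eLpNorm_sum_le (p := 2) (μ := μ) (s := s)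
        (f := fun (g : StrongDual ℝ G) t => |g (J (P (v n t)))|)
        (fun g _ => (((g ∘L J) ∘L P).continuous.comp_aestronglyMeasurable
          (Lp.aestronglyMeasurable (v n))).norm) (by norm_num)
      have h3 : (∑ g ∈ s, fun t => |g (J (P (v n t)))|) =
          fun t => ∑ g ∈ s, |g (J (P (v n t)))| := by
        ext t; simp
      rw [h3] at h2
      refine h2.trans (Finset.sum_le_sum fun g _ => ?_)
      rw [Lp.enorm_def]
      refine eLpNorm_mono_ae ?_
      filter_upwards [((g ∘L J) ∘L P).coeFn_compLp (v n)] with t ht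
      rw [ht]
      simp
    have h4 : ‖P.compLp (v n)‖ₑ ≤ ENNReal.ofReal (ε / (2 * (C + 1))) * ‖v n‖ₑ
        + ∑ g ∈ s, ‖((g ∘L J) ∘L P).compLp (v n)‖ₑ := by
      have hm1 : AEStronglyMeasurable (fun t => (ε / (2 * (C + 1))) * ‖v n t‖) μ :=
        (Lp.aestronglyMeasurable (v n)).norm.const_mul _
      have hm2 : AEStronglyMeasurable (fun t => ∑ g ∈ s, |g (J (P (v n t)))|) μ :=
        Finset.aestronglyMeasurable_fun_sum _ fun g _ =>
          (((g ∘L J) ∘L P).continuous.comp_aestronglyMeasurable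
          (Lp.aestronglyMeasurable (v n))).norm
      calc ‖P.compLp (v n)‖ₑ
          ≤ eLpNorm ((fun t => (ε / (2 * (C + 1))) * ‖v n t‖)
              + fun t => ∑ g ∈ s, |g (J (P (v n t)))|) 2 μ := by
            rw [Lp.enorm_def]
            refine eLpNorm_mono_ae ?_
            filter_upwards [P.coeFn_compLp (v n)] with t ht
            rw [ht]
            exact (hs _).trans (le_abs_self _)
        _ ≤ _ := eLpNorm_add_le hm1 hm2 one_le_two
        _ ≤ _ := by
            refine add_le_add ?_ (hsumm s)
            rw [Lp.enorm_def]
            refine (eLpNorm_le_mul_eLpNorm_of_ae_le_mul (g := fun t => v n t)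
              (c := ε / (2 * (C + 1))) (ae_of_all _ fun t => ?_) 2)
            rw [norm_mul, norm_norm, Real.norm_of_nonneg (by positivity)]
    have h6 : ENNReal.ofReal (ε / (2 * (C + 1))) * ‖v n‖ₑ ≠ ⊤ :=
      ENNReal.mul_ne_top ENNReal.ofReal_ne_top enorm_ne_top
    have h7 : ∀ g ∈ s, ‖((g ∘L J) ∘L P).compLp (v n)‖ₑ ≠ ⊤ := fun g _ => enorm_ne_top
    have h8 : ∑ g ∈ s, ‖((g ∘L J) ∘L P).compLp (v n)‖ₑ ≠ ⊤ := ENNReal.sum_ne_top.2 h7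
    have h5 := ENNReal.toReal_mono (ENNReal.add_ne_top.2 ⟨h6, h8⟩) h4
    rw [ENNReal.toReal_add h6 h8, ENNReal.toReal_mul,
      ENNReal.toReal_ofReal (by positivity), ENNReal.toReal_sum h7] at h5
    simpa only [toReal_enorm, mul_comm] using h5
  have h2 := hN n hn
  rw [Real.dist_0_eq_abs] at h2 ⊢
  have h3 := (le_abs_self _).trans_lt h2
  have h4 : ‖v n‖ * (ε / (2 * (C + 1))) ≤ ε / 2 := by
    have : ‖v n‖ ≤ C + 1 := (hC n).trans (by linarith)
    calc ‖v n‖ * (ε / (2 * (C + 1))) ≤ (C + 1) * (ε / (2 * (C + 1))) := by gcongr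
      _ = ε / 2 := by field_simp
  rw [abs_norm]
  linarith

end BochnerConvergence

namespace Architecture

variable {m : ℕ} (A : Architecture m)

lemma continuous_layer_uncurry {σ : ℝ → ℝ} (hσ : Continuous σ) (l : Fin A.depth) :
    Continuous fun q : A.Params × EuclideanSpace ℝ (Fin (A.width l)) =>
      A.layer σ q.1 l q.2 := by
  have h1 : Continuous fun q : A.Params × EuclideanSpace ℝ (Fin (A.width l)) =>
      (q.1 l).1 q.2 + (q.1 l).2 := by
    have h2 : Continuous fun q : A.Params × EuclideanSpace ℝ (Fin (A.width l)) => q.1 l :=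
      (continuous_apply l).comp continuous_fst
    exact (h2.fst.clm_apply continuous_snd).add h2.snd
  unfold layer
  split_ifs
  · exact h1
  · refine (PiLp.continuous_toLp 2 _).comp (continuous_pi fun i => hσ.comp ?_)
    exact (EuclideanSpace.proj (𝕜 := ℝ) i).continuous.comp h1

lemma continuous_layers_uncurry {σ : ℝ → ℝ} (hσ : Continuous σ) (l : ℕ) (h : l ≤ A.depth) :
    Continuous fun q : A.Params × EuclideanSpace ℝ (Fin (A.width 0)) =>
      A.layers σ q.1 l h q.2 := by
  induction l with
  | zero => exact continuous_snd
  | succ l ih =>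
    exact (A.continuous_layer_uncurry hσ ⟨l, h⟩).comp (continuous_fst.prodMk (ih _))

lemma continuous_input_uncurry :
    Continuous fun q : EuclideanSpace ℝ (Fin m) × ℝ => A.input q.1 q.2 := by
  refine (PiLp.continuous_toLp 2 _).comp (continuous_pi fun i => ?_)
  refine Fin.lastCases (motive := fun j => Continuous fun q : EuclideanSpace ℝ (Fin m) × ℝ =>
    (Fin.snoc (α := fun _ => ℝ) (fun j => q.1 j) q.2 j : ℝ)) ?_ ?_ (Fin.cast A.width_zero i)
  · simpa using continuous_snd
  · intro j
    simp only [Fin.snoc_castSucc]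
    exact (EuclideanSpace.proj (𝕜 := ℝ) j).continuous.comp continuous_fst

/-- The network depends continuously on its parameters and its input jointly. -/
lemma continuous_net_uncurry {σ : ℝ → ℝ} (hσ : Continuous σ) :
    Continuous fun q : (A.Params × EuclideanSpace ℝ (Fin m)) × ℝ =>
      A.net σ q.1.1 q.1.2 q.2 := by
  have h1 : Continuous fun q : (A.Params × EuclideanSpace ℝ (Fin m)) × ℝ =>
      A.input q.1.2 q.2 :=
    A.continuous_input_uncurry.comp (continuous_fst.snd.prodMk continuous_snd)
  exact (EuclideanSpace.proj (𝕜 := ℝ) (Fin.cast A.width_depth.symm 0)).continuous.comp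
    ((A.continuous_layers_uncurry hσ A.depth le_rfl).comp (continuous_fst.fst.prodMk h1))

end Architecture

/-- A modulus of continuity, uniform along a convergent sequence of parameters. -/
lemma exists_modulus {Q : Type*} [PseudoMetricSpace Q] {g : Q × ℝ → ℝ} (hg : Continuous g)
    {q : ℕ → Q} {q' : Q} (hq : Tendsto q atTop (𝓝 q')) (R : ℝ) {ε : ℝ} (hε : 0 < ε) :
    ∃ C, 0 ≤ C ∧ ∀ᶠ n in atTop, ∀ y y' : ℝ, |y| ≤ R → |y'| ≤ R →
      |g (q n, y) - g (q', y')| ≤ ε + C * |y - y'| := by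
  have hc : IsCompact (insert q' (range q) ×ˢ Icc (-R) R) :=
    hq.isCompact_insert_range.prod isCompact_Icc
  obtain ⟨B, hB⟩ := hc.exists_bound_of_continuousOn hg.continuousOn
  obtain ⟨δ, hδ, hu⟩ := Metric.uniformContinuousOn_iff.1
    (hc.uniformContinuousOn_of_continuous hg.continuousOn) ε hε
  refine ⟨2 * |B| / δ, by positivity, ?_⟩
  filter_upwards [Metric.tendsto_nhds.1 hq δ hδ] with n hn y y' hy hy'
  have h1 : (q n, y) ∈ insert q' (range q) ×ˢ Icc (-R) R :=
    ⟨mem_insert_of_mem _ ⟨n, rfl⟩, abs_le.1 hy⟩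
  have h2 : (q', y') ∈ insert q' (range q) ×ˢ Icc (-R) R := ⟨mem_insert _ _, abs_le.1 hy'⟩
  rcases lt_or_ge |y - y'| δ with h | h
  · have h3 := hu _ h1 _ h2 (by
      rw [Prod.dist_eq]
      exact max_lt hn h)
    rw [Real.dist_eq] at h3
    have : 0 ≤ 2 * |B| / δ * |y - y'| := by positivity
    linarith
  · have h3 := hB _ h1
    have h4 := hB _ h2
    rw [Real.norm_eq_abs] at h3 h4
    have h5 : 2 * |B| ≤ 2 * |B| / δ * |y - y'| := by
      rw [div_mul_eq_mul_div, le_div_iff₀ hδ]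
      gcongr
    linarith [abs_sub (g (q n, y)) (g (q', y')), le_abs_self B]

/-- A pointwise affine bound between norms gives a bound between the norms of `L^p`. -/
lemma norm_le_add_of_ae_le {α : Type*} [MeasurableSpace α] {μ : Measure α} [IsFiniteMeasure μ]
    {q : ℝ≥0∞} [Fact (1 ≤ q)] {E F : Type*} [NormedAddCommGroup E] [NormedAddCommGroup F]
    {f : Lp E q μ} {g : Lp F q μ} {ε C : ℝ} (hε : 0 ≤ ε) (hC : 0 ≤ C)
    (h : ∀ᵐ t ∂μ, ‖f t‖ ≤ ε + C * ‖g t‖) :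
    ‖f‖ ≤ ε * μ.real univ ^ (1 / q.toReal) + C * ‖g‖ := by
  have hg : MemLp (fun t => ‖g t‖) q μ := (Lp.memLp g).norm
  have h1 : ‖f‖ ≤ ‖Lp.const q μ ε + C • hg.toLp _‖ := by
    refine Lp.norm_le_norm_of_ae_le ?_
    filter_upwards [h, Lp.coeFn_add (Lp.const q μ ε) (C • hg.toLp _), Lp.coeFn_const q μ ε,
      Lp.coeFn_smul C (hg.toLp _), hg.coeFn_toLp] with t h1 h2 h3 h4 h5
    rw [h2, Pi.add_apply, h3, h4, Pi.smul_apply, h5, smul_eq_mul, Function.const_apply]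
    exact h1.trans (le_abs_self _)
  refine h1.trans ((norm_add_le _ _).trans (add_le_add ?_ ?_))
  · refine (Lp.norm_const_le ..).trans_eq ?_
    rw [Real.norm_of_nonneg hε]
  · rw [norm_smul, Real.norm_of_nonneg hC, Lp.norm_toLp, eLpNorm_norm, Lp.norm_def]

lemma tendsto_of_ae_le {α : Type*} [MeasurableSpace α] {μ : Measure α} [IsFiniteMeasure μ]
    {q : ℝ≥0∞} [Fact (1 ≤ q)] {E F : Type*} [NormedAddCommGroup E] [NormedAddCommGroup F]
    {f : ℕ → Lp E q μ} {f' : Lp E q μ} {g : ℕ → Lp F q μ} (hg : Tendsto g atTop (𝓝 0))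
    (h : ∀ ε : ℝ, 0 < ε → ∃ C, 0 ≤ C ∧ ∀ᶠ n in atTop, ∀ᵐ t ∂μ,
      ‖f n t - f' t‖ ≤ ε + C * ‖g n t‖) : Tendsto f atTop (𝓝 f') := by
  rw [Metric.tendsto_nhds]
  intro ε hε
  set c : ℝ := μ.real univ ^ (1 / q.toReal)
  have hc : 0 ≤ c := by positivity
  obtain ⟨C, hC, hn⟩ := h (ε / (2 * (c + 1))) (by positivity)
  have hg2 : Tendsto (fun n => C * ‖g n‖) atTop (𝓝 0) := by
    simpa using hg.norm.const_mul C
  filter_upwards [hn, hg2.eventually_lt_const (half_pos hε)] with n h1 h2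
  have h3 : ∀ᵐ t ∂μ, ‖(f n - f' : Lp E q μ) t‖ ≤ ε / (2 * (c + 1)) + C * ‖g n t‖ := by
    filter_upwards [h1, Lp.coeFn_sub (f n) f'] with t h4 h5
    rwa [h5]
  have h4 := norm_le_add_of_ae_le (by positivity) hC h3
  have h5 : ε / (2 * (c + 1)) * c ≤ ε / 2 := by
    calc ε / (2 * (c + 1)) * c ≤ ε / (2 * (c + 1)) * (c + 1) := by gcongr; linarith
      _ = ε / 2 := by field_simp
  rw [dist_eq_norm]
  exact h4.trans_lt (by linarith)

namespace Setting

variable {d : ℕ} {Ω : Set (EuclideanSpace ℝ (Fin d))} {T : ℝ} {p : ℝ≥0∞} [Fact (1 ≤ p)]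
  {X V W Y Vt U₀ H : Type*}
  [NormedAddCommGroup X] [NormedSpace ℝ X] [NormedAddCommGroup V] [NormedSpace ℝ V]
  [NormedAddCommGroup W] [NormedSpace ℝ W] [NormedAddCommGroup Y] [NormedSpace ℝ Y]
  [NormedAddCommGroup Vt] [NormedSpace ℝ Vt] [NormedAddCommGroup U₀] [NormedSpace ℝ U₀]
  [NormedAddCommGroup H] [NormedSpace ℝ H]
  (S : Setting Ω T p X V W Y Vt U₀ H)

/-- The embedding of the state space into `L²(0,T;V)`. -/
noncomputable def stateFst : S.State →L[ℝ] BochnerL2 T V :=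
  WithLp.fstL 2 ℝ _ _ ∘L (stateSpace T (S.H_Vt ∘L S.V_H)).subtypeL

/-- The embedding of the state space into `H` at a point of time. -/
noncomputable def evalAt (t : Icc (0 : ℝ) T) : S.State →L[ℝ] H :=
  ContinuousMap.evalCLM ℝ t ∘L S.toC

variable {S} {u : ℕ → S.State} {u' : S.State}

lemma weakConv_ae (hu : WeakConv u u') : ∀ᵐ t ∂(timeMeasure T),
    WeakConv (fun n => S.V_H ((u n).1.fst t)) (S.V_H (u'.1.fst t)) := by
  filter_upwards [ae_all_iff.2 fun n => S.toC_spec (u n), S.toC_spec u',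
    ae_restrict_mem measurableSet_Ioo] with t h1 h2 h3
  have ht := Ioo_subset_Icc_self h3
  have h4 := hu.map (S.evalAt ⟨t, ht⟩)
  simp only [← h1 _ ht, ← h2 ht]
  exact h4

lemma ae_norm_V_H_le (S : Setting Ω T p X V W Y Vt U₀ H) (u : S.State) :
    ∀ᵐ t ∂(timeMeasure T), ‖S.V_H (u.1.fst t)‖ ≤ ‖S.toC‖ * ‖u‖ := by
  filter_upwards [S.toC_spec u, ae_restrict_mem measurableSet_Ioo] with t h2 h3
  rw [← h2 (Ioo_subset_Icc_self h3)]
  exact (ContinuousMap.norm_coe_le_norm _ _).trans (S.toC.le_opNorm u)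

/-- Weakly convergent states converge strongly in `L²(0,T;E)` if `V` embeds compactly into `E`. -/
lemma tendsto_compLp_state {E : Type*} [NormedAddCommGroup E] [NormedSpace ℝ E]
    (P : V →L[ℝ] E) (hP : IsCompactOperator P) (J : E →L[ℝ] W) (hJ : Function.Injective J)
    (hJP : ∀ v, J (P v) = S.H_W (S.V_H v)) (hu : WeakConv u u') :
    Tendsto (fun n => P.compLp ((u n - u').1.fst)) atTop (𝓝 0) := by
  have hd : WeakConv (fun n => u n - u') 0 := by
    simpa using hu.sub (WeakConv.const u')
  obtain ⟨C, hC⟩ := (hd.map S.stateFst).exists_norm_le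
  obtain ⟨R, hR⟩ := hd.exists_norm_le
  refine tendsto_compLp_of_isCompactOperator P hP J hJ (C := C)
    (R := ‖S.H_W‖ * (‖S.toC‖ * R)) hC ?_ ?_
  · filter_upwards [ae_all_iff.2 fun n => S.ae_norm_V_H_le (u n - u')] with t ht n
    rw [hJP]
    exact S.H_W.le_opNorm_of_le ((ht n).trans (by gcongr; exact hR n))
  · filter_upwards [weakConv_ae hd, Lp.coeFn_zero V 2 (timeMeasure T)] with t h1 h2
    simp only [hJP]
    have h3 : ((0 : S.State).1.fst) t = 0 := h2
    rw [h3, map_zero] at h1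
    simpa using h1.map S.H_W

section Network

variable {m : ℕ} (A : Architecture m) {σ : ℝ → ℝ}

/-- The network operator is continuous from the weak topology on the states to the norm
topology. -/
lemma tendsto_nemN (hσ : Continuous σ) {α : ℕ → EuclideanSpace ℝ (Fin m)}
    {α' : EuclideanSpace ℝ (Fin m)} {θ : ℕ → A.Params} {θ' : A.Params}
    (hα : Tendsto α atTop (𝓝 α')) (hθ : Tendsto θ atTop (𝓝 θ')) (hu : WeakConv u u') :
    Tendsto (fun n => S.nemN A hσ (α n) (u n) (θ n)) atTop (𝓝 (S.nemN A hσ α' u' θ')) := by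
  have : IsFiniteMeasure ((volume : Measure (EuclideanSpace ℝ (Fin d))).restrict Ω) :=
    ⟨by rw [Measure.restrict_apply_univ]; exact S.isBounded_domain.measure_lt_top⟩
  obtain ⟨R₀, hR₀⟩ := hu.exists_norm_le
  set R : ℝ := ‖S.toLinfty‖ * max R₀ ‖u'‖
  have hbound : ∀ w : S.State, ‖w‖ ≤ max R₀ ‖u'‖ → ∀ᵐ t ∂(timeMeasure T),
      ∀ᵐ x ∂(volume.restrict Ω), |S.toLinfty w (t, x)| ≤ R := by
    intro w hw
    refine Measure.ae_ae_of_ae_prod (p := fun z => |S.toLinfty w z| ≤ R) ?_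
    filter_upwards [ae_le_eLpNormEssSup (f := S.toLinfty w)
      (μ := (timeMeasure T).prod (volume.restrict Ω))] with z hz
    have h1 : ‖S.toLinfty w‖ ≤ R := S.toLinfty.le_opNorm_of_le hw
    refine le_trans ?_ h1
    rw [Lp.norm_def, eLpNorm_exponent_top, ← Real.norm_eq_abs, ← toReal_enorm]
    refine ENNReal.toReal_mono ?_ hz
    rw [← eLpNorm_exponent_top]
    exact Lp.eLpNorm_ne_top _
  have hstrong := tendsto_compLp_state S.V_Lp S.V_Lp_compact S.Lp_W S.Lp_W_injective S.V_Lp_W hu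
  refine tendsto_of_ae_le hstrong fun ε hε => ?_
  set c : ℝ := (volume.restrict Ω).real univ ^ (1 / p.toReal)
  have hc : 0 ≤ c := by positivity
  obtain ⟨C, hC, hmod⟩ := exists_modulus (A.continuous_net_uncurry hσ) (hθ.prodMk_nhds hα) R
    (show 0 < ε / (c + 1) by positivity)
  refine ⟨C, hC, hmod.mono fun n hn => ?_⟩
  filter_upwards [hbound (u n) ((hR₀ n).trans (le_max_left _ _)), hbound u' (le_max_right _ _),
    S.nemN_spec A hσ (α n) (u n) (θ n), S.nemN_spec A hσ α' u' θ', S.toLinfty_spec (u n),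
    S.toLinfty_spec u', S.V_Lp.coeFn_compLp ((u n - u').1.fst),
    Lp.coeFn_sub (u n).1.fst u'.1.fst] with t h1 h2 h3 h4 h5 h6 h7 h8
  have h9 : ((u n - u').1.fst) t = (u n).1.fst t - u'.1.fst t := h8
  rw [h7, h9, map_sub]
  have h10 : ‖S.nemN A hσ (α n) (u n) (θ n) t - S.nemN A hσ α' u' θ' t‖ ≤
      ε / (c + 1) * c + C * ‖S.V_Lp ((u n).1.fst t) - S.V_Lp (u'.1.fst t)‖ := by
    refine norm_le_add_of_ae_le (by positivity) hC ?_
    filter_upwards [h1, h2, h3, h4, h5, h6,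
      Lp.coeFn_sub (S.nemN A hσ (α n) (u n) (θ n) t) (S.nemN A hσ α' u' θ' t),
      Lp.coeFn_sub (S.V_Lp ((u n).1.fst t)) (S.V_Lp (u'.1.fst t))]
      with x g1 g2 g3 g4 g5 g6 g7 g8
    rw [g7, g8, Pi.sub_apply, Pi.sub_apply, g3, g4, ← g5, ← g6, Real.norm_eq_abs,
      Real.norm_eq_abs]
    exact hn _ _ g1 g2
  refine h10.trans (add_le_add_left ?_ _)
  calc ε / (c + 1) * c ≤ ε / (c + 1) * (c + 1) := by gcongr; linarith
    _ = ε := by field_simp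

end Network

end Setting

/-- A sequence that is bounded in `L²`, multiplied by a null sequence of `L²`, tends to zero
almost everywhere along a subsequence. -/
lemma exists_subseq_tendsto_norm_mul_norm {α : Type*} [MeasurableSpace α] {μ : Measure α}
    {E F : Type*} [NormedAddCommGroup E] [NormedAddCommGroup F] {f : ℕ → Lp E 2 μ}
    {g : ℕ → Lp F 2 μ} {C : ℝ} (hf : Tendsto f atTop (𝓝 0)) (hg : ∀ n, ‖g n‖ ≤ C) :
    ∃ φ : ℕ → ℕ, StrictMono φ ∧
      ∀ᵐ t ∂μ, Tendsto (fun n => ‖f (φ n) t‖ * ‖g (φ n) t‖) atTop (𝓝 0) := by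
  have hmf : ∀ n, AEStronglyMeasurable (fun t => ‖f n t‖) μ := fun n =>
    (Lp.aestronglyMeasurable (f n)).norm
  have hmg : ∀ n, AEStronglyMeasurable (fun t => ‖g n t‖) μ := fun n =>
    (Lp.aestronglyMeasurable (g n)).norm
  have h1 : ∀ n, eLpNorm (fun t => ‖f n t‖ * ‖g n t‖) 1 μ ≤ ‖f n‖ₑ * ENNReal.ofReal C := by
    intro n
    have h := eLpNorm_smul_le_mul_eLpNorm (p := 2) (q := 2) (r := 1) (hmg n) (hmf n)
    rw [eLpNorm_norm, eLpNorm_norm, ← Lp.enorm_def, ← Lp.enorm_def] at h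
    refine h.trans ?_
    gcongr
    rw [← ofReal_norm]
    exact ENNReal.ofReal_le_ofReal (hg n)
  have h2 : Tendsto (fun n => ‖f n‖ₑ * ENNReal.ofReal C) atTop (𝓝 0) := by
    have h3 := hf.enorm
    rw [enorm_zero] at h3
    simpa using ENNReal.Tendsto.mul_const h3 (Or.inr (ENNReal.ofReal_ne_top (r := C)))
  have h3 := tendsto_of_tendsto_of_tendsto_of_le_of_le tendsto_const_nhds h2
    (fun _ => zero_le) h1
  obtain ⟨φ, hφ, h⟩ := (tendstoInMeasure_of_tendsto_eLpNorm (g := fun _ => (0 : ℝ)) one_ne_zero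
    (fun n => (hmf n).mul (hmg n)) aestronglyMeasurable_const
    (by simpa [Pi.sub_def] using h3)).exists_seq_tendsto_ae
  exact ⟨φ, hφ, h⟩

/-- Two one-sided bounds for upper limits, up to a null sequence, give convergence. -/
lemma tendsto_of_limsup_le {q x : ℕ → ℝ} {a : ℝ} (hq : Tendsto q atTop (𝓝 0))
    (h₁ : limsup (fun n => ((q n + x n : ℝ) : EReal)) atTop ≤ (a : EReal))
    (h₂ : limsup (fun n => ((q n - x n : ℝ) : EReal)) atTop ≤ ((-a : ℝ) : EReal)) :
    Tendsto x atTop (𝓝 a) := by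
  rw [Metric.tendsto_nhds]
  intro ε hε
  have g1 : limsup (fun n => ((q n + x n : ℝ) : EReal)) atTop < ((a + ε / 2 : ℝ) : EReal) :=
    h₁.trans_lt (EReal.coe_lt_coe_iff.2 (by linarith))
  have g2 : limsup (fun n => ((q n - x n : ℝ) : EReal)) atTop < ((-a + ε / 2 : ℝ) : EReal) :=
    h₂.trans_lt (EReal.coe_lt_coe_iff.2 (by linarith))
  filter_upwards [eventually_lt_of_limsup_lt g1, eventually_lt_of_limsup_lt g2,
    Metric.tendsto_nhds.1 hq (ε / 2) (half_pos hε)] with n k1 k2 k3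
  rw [EReal.coe_lt_coe_iff] at k1 k2
  rw [Real.dist_eq, sub_zero, abs_lt] at k3
  rw [Real.dist_eq, abs_lt]
  constructor <;> linarith [k3.1, k3.2]

namespace Setting

variable {d : ℕ} {Ω : Set (EuclideanSpace ℝ (Fin d))} {T : ℝ} {p : ℝ≥0∞} [Fact (1 ≤ p)]
  {X V W Y Vt U₀ H : Type*}
  [NormedAddCommGroup X] [NormedSpace ℝ X] [NormedAddCommGroup V] [NormedSpace ℝ V]
  [NormedAddCommGroup W] [NormedSpace ℝ W] [NormedAddCommGroup Y] [NormedSpace ℝ Y]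
  [NormedAddCommGroup Vt] [NormedSpace ℝ Vt] [NormedAddCommGroup U₀] [NormedSpace ℝ U₀]
  [NormedAddCommGroup H] [NormedSpace ℝ H]
  {S : Setting Ω T p X V W Y Vt U₀ H}
  {lam : ℕ → X} {lam' : X} {u : ℕ → S.State} {u' : S.State}

lemma WeaklyContinuousModel.weakConv_ae_F (hF : S.WeaklyContinuousModel)
    (hlam : WeakConv lam lam') (hu : WeakConv u u') : ∀ᵐ t ∂(timeMeasure T),
      WeakConv (fun n => S.F t (lam n) ((u n).1.fst t)) (S.F t lam' (u'.1.fst t)) := by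
  obtain ⟨FH, hFH⟩ := hF
  filter_upwards [hFH, weakConv_ae hu] with t h1 h2
  have h3 := h1.2 _ _ (hlam.prodMk h2)
  simpa only [h1.1] using h3

lemma PseudomonotoneModel.exists_subseq_weakConv_ae_F (hF : S.PseudomonotoneModel)
    (hlam : WeakConv lam lam') (hu : WeakConv u u') {C : ℝ}
    (hC : ∀ n, ‖S.nemF (lam n) (u n)‖ ≤ C) :
    ∃ φ : ℕ → ℕ, StrictMono φ ∧ ∀ᵐ t ∂(timeMeasure T),
      WeakConv (fun n => S.F t (lam (φ n)) ((u (φ n)).1.fst t)) (S.F t lam' (u'.1.fst t)) := by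
  obtain ⟨hcomp, j, -, hj⟩ := hF
  obtain ⟨φ, hφ, h0⟩ := exists_subseq_tendsto_norm_mul_norm
    (tendsto_compLp_state S.V_H hcomp S.H_W S.H_W_injective (fun _ => rfl) hu) hC
  refine ⟨φ, hφ, ?_⟩
  have hw : ∀ n, ∀ᵐ t ∂(timeMeasure T), S.V_H.compLp ((u n - u').1.fst) t =
      S.V_H ((u n).1.fst t) - S.V_H (u'.1.fst t) := by
    intro n
    filter_upwards [S.V_H.coeFn_compLp ((u n - u').1.fst), Lp.coeFn_sub (u n).1.fst u'.1.fst]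
      with t h1 h2
    have h3 : ((u n - u').1.fst) t = (u n).1.fst t - u'.1.fst t := h2
    rw [h1, h3, map_sub]
  filter_upwards [hj, h0, ae_all_iff.2 hw, weakConv_ae hu,
    ae_all_iff.2 fun n => (S.memLp_F (lam n) (u n)).coeFn_toLp] with t h1 h2 h3 h4 h5
  set q : ℕ → ℝ := fun n => j (S.V_H ((u (φ n)).1.fst t) - S.V_H (u'.1.fst t))
    (S.F t (lam (φ n)) ((u (φ n)).1.fst t)) with hqdef
  have hq : Tendsto q atTop (𝓝 0) := by
    have h6 := h2.const_mul ‖j‖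
    rw [mul_zero] at h6
    refine squeeze_zero_norm (fun n => ?_) h6
    have h7 : S.nemF (lam (φ n)) (u (φ n)) t = S.F t (lam (φ n)) ((u (φ n)).1.fst t) := h5 _
    rw [h3, h7, ← mul_assoc]
    exact j.le_opNorm₂ _ _
  have key := h1 (fun n => lam (φ n)) lam' (fun n => (u (φ n)).1.fst t) (u'.1.fst t)
    (h4.subseq hφ) (hlam.subseq hφ) (by
      have h6 : Tendsto (fun n => (q n : EReal)) atTop (𝓝 ((0 : ℝ) : EReal)) :=
        (continuous_coe_real_ereal.tendsto 0).comp hq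
      rw [h6.liminf_eq, EReal.coe_zero])
  intro v
  refine tendsto_of_limsup_le hq ?_ ?_
  · have h6 := key (j (S.V_H (u'.1.fst t)) - v)
    convert h6 using 3
    · simp only [hqdef, map_sub, sub_apply]
      congr 1
      ring
    · simp
  · have h6 := key (j (S.V_H (u'.1.fst t)) + v)
    convert h6 using 3
    · simp only [hqdef, map_sub, sub_apply, add_apply]
      congr 1
      ring
    · simp

lemma exists_subseq_weakConv_ae_nemF (hF : S.WeaklyContinuousModel ∨ S.PseudomonotoneModel)
    (hlam : WeakConv lam lam') (hu : WeakConv u u') {C : ℝ}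
    (hC : ∀ n, ‖S.nemF (lam n) (u n)‖ ≤ C) :
    ∃ φ : ℕ → ℕ, StrictMono φ ∧ ∀ᵐ t ∂(timeMeasure T),
      WeakConv (fun n => S.nemF (lam (φ n)) (u (φ n)) t) (S.nemF lam' u' t) := by
  obtain ⟨φ, hφ, h⟩ : ∃ φ : ℕ → ℕ, StrictMono φ ∧ ∀ᵐ t ∂(timeMeasure T),
      WeakConv (fun n => S.F t (lam (φ n)) ((u (φ n)).1.fst t)) (S.F t lam' (u'.1.fst t)) := by
    rcases hF with hF | hF
    · exact ⟨id, strictMono_id, hF.weakConv_ae_F hlam hu⟩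
    · exact hF.exists_subseq_weakConv_ae_F hlam hu hC
  refine ⟨φ, hφ, ?_⟩
  filter_upwards [h, (S.memLp_F lam' u').coeFn_toLp,
    ae_all_iff.2 fun n => (S.memLp_F (lam n) (u n)).coeFn_toLp] with t h1 h2 h3
  have h4 : ∀ n, S.nemF (lam n) (u n) t = S.F t (lam n) ((u n).1.fst t) := h3
  have h5 : S.nemF lam' u' t = S.F t lam' (u'.1.fst t) := h2
  simpa only [h4, h5] using h1

end Setting

section LowerSemicontinuity

/-- Superadditivity of lower limits. -/
lemma add_le_liminf_add {f g : ℕ → ℝ≥0∞} {a b : ℝ≥0∞} (hf : a ≤ liminf f atTop)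
    (hg : b ≤ liminf g atTop) : a + b ≤ liminf (fun n => f n + g n) atTop := by
  refine (add_le_add hf hg).trans ?_
  simp only [liminf_eq_iSup_iInf_of_nat']
  rw [ENNReal.iSup_add_iSup_of_monotone]
  · exact iSup_mono fun n => le_iInf fun i => add_le_add (iInf_le _ i) (iInf_le _ i)
  all_goals
    intro m n hmn
    refine le_iInf fun i => (iInf_le _ (n - m + i)).trans_eq ?_
    congr 1
    omega

lemma sum_le_liminf_sum {ι : Type*} (s : Finset ι) {f : ι → ℕ → ℝ≥0∞} {a : ι → ℝ≥0∞}
    (h : ∀ i, a i ≤ liminf (f i) atTop) :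
    ∑ i ∈ s, a i ≤ liminf (fun n => ∑ i ∈ s, f i n) atTop := by
  classical
  induction s using Finset.induction_on with
  | empty => simp
  | insert i s hi ih =>
    simp only [Finset.sum_insert hi]
    exact add_le_liminf_add (h i) ih

lemma sq_le_liminf_sq {f : ℕ → ℝ≥0∞} {a : ℝ≥0∞} (h : a ≤ liminf f atTop) :
    a ^ 2 ≤ liminf (fun n => f n ^ 2) atTop := by
  have h1 := (ENNReal.orderIsoRpow 2 two_pos).liminf_apply (f := atTop) (u := f)
  simp only [ENNReal.orderIsoRpow_apply, ENNReal.rpow_two] at h1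
  rw [← h1]
  gcongr

/-- A sequential criterion for the lower semicontinuity of the norm along a sequence. -/
lemma enorm_le_liminf_of_forall_subseq {E : Type*} [NormedAddCommGroup E] {x : ℕ → E} {a : E}
    (h : ∀ (φ : ℕ → ℕ) (r : ℝ), StrictMono φ → (∀ n, ‖x (φ n)‖ ≤ r) → ‖a‖ ≤ r) :
    ‖a‖ₑ ≤ liminf (fun n => ‖x n‖ₑ) atTop := by
  refine le_of_forall_gt_imp_ge_of_dense fun c hc => ?_
  rcases eq_or_ne c ⊤ with rfl | hctop
  · exact le_top
  obtain ⟨φ, hφ, hlt⟩ := extraction_of_frequently_atTop (frequently_lt_of_liminf_lt (by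
    isBoundedDefault) hc)
  have h1 := h φ c.toReal hφ fun n => by
    rw [← toReal_enorm]
    exact ENNReal.toReal_mono hctop (hlt n).le
  rw [← ofReal_norm]
  exact (ENNReal.ofReal_le_ofReal h1).trans_eq (ENNReal.ofReal_toReal hctop)

/-- The direct method of the calculus of variations. -/
lemma exists_forall_le_of_subseq {Z : Type*} [Nonempty Z] (J : Z → ℝ≥0∞)
    (h : ∀ (c : ℝ≥0) (z : ℕ → Z), (∀ n, J (z n) ≤ c) →
      ∃ (a : Z) (φ : ℕ → ℕ), StrictMono φ ∧ J a ≤ liminf (fun n => J (z (φ n))) atTop) :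
    ∃ z, ∀ z', J z ≤ J z' := by
  rcases eq_or_ne (⨅ z, J z) ⊤ with htop | htop
  · exact ⟨Classical.arbitrary Z, fun z' => by simp [iInf_eq_top.1 htop]⟩
  have h1 : ∀ n : ℕ, ∃ z, J z < (⨅ z, J z) + ((n : ℝ≥0∞) + 1)⁻¹ := fun n =>
    iInf_lt_iff.1 (ENNReal.lt_add_right htop (by simp))
  choose z hz using h1
  have hle : ∀ n, J (z n) ≤ (((⨅ z, J z) + 1).toNNReal : ℝ≥0) := fun n => by
    rw [ENNReal.coe_toNNReal (ENNReal.add_ne_top.2 ⟨htop, ENNReal.one_ne_top⟩)]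
    refine (hz n).le.trans (add_le_add_right ?_ _)
    exact ENNReal.inv_le_one.2 le_add_self
  obtain ⟨a, φ, hφ, ha⟩ := h _ z hle
  refine ⟨a, fun z' => (ha.trans ?_).trans (iInf_le J z')⟩
  have h2 : Tendsto (fun n : ℕ => (⨅ z, J z) + ((n : ℝ≥0∞) + 1)⁻¹) atTop (𝓝 (⨅ z, J z)) := by
    have h3 : Tendsto (fun n : ℕ => ((n : ℝ≥0∞) + 1)⁻¹) atTop (𝓝 0) := by
      have := (tendsto_add_atTop_iff_nat 1).2 ENNReal.tendsto_inv_nat_nhds_zero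
      simpa using this
    simpa using tendsto_const_nhds.add h3
  have h4 := h2.comp hφ.tendsto_atTop
  rw [← h4.liminf_eq]
  exact liminf_le_liminf (Eventually.of_forall fun n => (hz (φ n)).le)

/-- Finitely many sequences in a weakly precompact set have a common index sequence along which
all of them converge weakly. -/
lemma WeaklyPrecompact.exists_common_subseq {E ι : Type*} [NormedAddCommGroup E]
    [NormedSpace ℝ E] {s : Set E} (hs : WeaklyPrecompact s) (I : Finset ι) {x : ι → ℕ → E}
    (hx : ∀ i n, x i n ∈ s) :
    ∃ φ : ℕ → ℕ, StrictMono φ ∧ ∀ i ∈ I, ∃ a, WeakConv (fun n => x i (φ n)) a := by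
  classical
  induction I using Finset.induction_on with
  | empty => exact ⟨id, strictMono_id, by simp⟩
  | insert i I _ ih =>
    obtain ⟨φ, hφ, h⟩ := ih
    obtain ⟨a, ψ, hψ, ha⟩ := hs (fun n => x i (φ n)) fun n => hx i _
    refine ⟨φ ∘ ψ, hφ.comp hψ, fun k hk => ?_⟩
    rcases Finset.mem_insert.1 hk with rfl | hk
    · exact ⟨a, ha⟩
    · obtain ⟨b, hb⟩ := h k hk
      exact ⟨b, hb.subseq hψ⟩

lemma enorm_sq_toLp_toLp {E F G : Type*} [NormedAddCommGroup E] [NormedAddCommGroup F]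
    [NormedAddCommGroup G] (x : E) (y : F) (z : G) :
    ‖WithLp.toLp 2 (x, WithLp.toLp 2 (y, z))‖ₑ ^ 2 = ‖x‖ₑ ^ 2 + (‖y‖ₑ ^ 2 + ‖z‖ₑ ^ 2) := by
  simp only [← ofReal_norm]
  rw [← ENNReal.ofReal_pow (norm_nonneg _), ← ENNReal.ofReal_pow (norm_nonneg _),
    ← ENNReal.ofReal_pow (norm_nonneg _), ← ENNReal.ofReal_pow (norm_nonneg _),
    ← ENNReal.ofReal_add (by positivity) (by positivity),
    ← ENNReal.ofReal_add (by positivity) (by positivity),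
    WithLp.prod_norm_sq_eq_of_L2, WithLp.prod_norm_sq_eq_of_L2]
  rfl

end LowerSemicontinuity

namespace Setting

variable {d m : ℕ} {Ω : Set (EuclideanSpace ℝ (Fin d))} {T : ℝ} {p : ℝ≥0∞} [Fact (1 ≤ p)]
  {X V W Y Vt U₀ H : Type*}
  [NormedAddCommGroup X] [NormedSpace ℝ X] [NormedAddCommGroup V] [NormedSpace ℝ V]
  [NormedAddCommGroup W] [NormedSpace ℝ W] [NormedAddCommGroup Y] [NormedSpace ℝ Y]
  [NormedAddCommGroup Vt] [NormedSpace ℝ Vt] [NormedAddCommGroup U₀] [NormedSpace ℝ U₀]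
  [NormedAddCommGroup H] [NormedSpace ℝ H]
  {S : Setting Ω T p X V W Y Vt U₀ H} (A : Architecture m) {σ : ℝ → ℝ}

lemma weakConv_timeDeriv {u : ℕ → S.State} {u' : S.State} (hu : WeakConv u u') :
    WeakConv (fun n => S.timeDeriv (u n)) (S.timeDeriv u') :=
  hu.map (S.Vt_W.compLpL 2 (timeMeasure T) ∘L WithLp.sndL 2 ℝ _ _ ∘L
    (stateSpace T (S.H_Vt ∘L S.V_H)).subtypeL)

lemma norm_residual_le (hF : S.WeaklyContinuousModel ∨ S.PseudomonotoneModel)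
    (hσ : Continuous σ) {lam : ℕ → X} {lam' : X} {α : ℕ → EuclideanSpace ℝ (Fin m)}
    {α' : EuclideanSpace ℝ (Fin m)} {u : ℕ → S.State} {u' : S.State} {θ : ℕ → A.Params}
    {θ' : A.Params} (hlam : WeakConv lam lam') (hα : Tendsto α atTop (𝓝 α'))
    (hu : WeakConv u u') (hθ : Tendsto θ atTop (𝓝 θ')) {r : ℝ}
    (hr : ∀ n, ‖S.timeDeriv (u n) - S.nemF (lam n) (u n)
      - S.Lp_W.compLp (S.nemN A hσ (α n) (u n) (θ n))‖ ≤ r) :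
    ‖S.timeDeriv u' - S.nemF lam' u' - S.Lp_W.compLp (S.nemN A hσ α' u' θ')‖ ≤ r := by
  set a : ℕ → BochnerL2 T W := fun n =>
    S.timeDeriv (u n) - S.Lp_W.compLp (S.nemN A hσ (α n) (u n) (θ n))
  have hN : Tendsto (fun n => S.Lp_W.compLp (S.nemN A hσ (α n) (u n) (θ n))) atTop
      (𝓝 (S.Lp_W.compLp (S.nemN A hσ α' u' θ'))) :=
    ((S.Lp_W.compLpL 2 (timeMeasure T)).continuous.tendsto _).comp (tendsto_nemN A hσ hα hθ hu)
  have ha : WeakConv a (S.timeDeriv u' - S.Lp_W.compLp (S.nemN A hσ α' u' θ')) :=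
    (weakConv_timeDeriv hu).sub (WeakConv.of_tendsto hN)
  obtain ⟨C, hC⟩ := ha.exists_norm_le
  have hbound : ∀ n, ‖S.nemF (lam n) (u n)‖ ≤ C + r := fun n => by
    have h1 : S.nemF (lam n) (u n) = a n - (S.timeDeriv (u n) - S.nemF (lam n) (u n)
      - S.Lp_W.compLp (S.nemN A hσ (α n) (u n) (θ n))) := by
      simp only [a]; abel
    rw [h1]
    exact (norm_sub_le _ _).trans (add_le_add (hC n) (hr n))
  obtain ⟨φ, hφ, hae⟩ := exists_subseq_weakConv_ae_nemF hF hlam hu hbound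
  have h2 := norm_add_le_of_weakConv_of_ae (f := fun n => -S.nemF (lam (φ n)) (u (φ n)))
    (f' := -S.nemF lam' u') (r := r) (ha.subseq hφ) (by
      filter_upwards [hae, Lp.coeFn_neg (S.nemF lam' u'),
        ae_all_iff.2 fun n => Lp.coeFn_neg (S.nemF (lam (φ n)) (u (φ n)))] with t h1 h2 h3
      simp only [h2, h3, Pi.neg_apply]
      simpa using h1.map (-ContinuousLinearMap.id ℝ W)) (fun n => by
      refine le_of_eq_of_le ?_ (hr (φ n))
      congr 1
      simp only [a]; abel)
  refine le_of_eq_of_le ?_ h2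
  congr 1
  abel

/-- Weak lower semicontinuity of the data misfit. -/
lemma misfit_le_liminf (hF : S.WeaklyContinuousModel ∨ S.PseudomonotoneModel)
    (hσ : Continuous σ) (y : BochnerL2 T Y) {x : ℕ → S.Unknowns m} {x' : S.Unknowns m}
    {θ : ℕ → A.Params} {θ' : A.Params} (hx : WeakConv x x') (hθ : Tendsto θ atTop (𝓝 θ')) :
    ‖S.forward A hσ x' θ' - target y‖ₑ ^ 2 ≤
      liminf (fun n => ‖S.forward A hσ (x n) (θ n) - target y‖ₑ ^ 2) atTop := by
  have hlam := hx.map (ContinuousLinearMap.fst ℝ X (EuclideanSpace ℝ (Fin m) × U₀ × S.State))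
  have hx2 := hx.map (ContinuousLinearMap.snd ℝ X (EuclideanSpace ℝ (Fin m) × U₀ × S.State))
  have hα := (hx2.map (ContinuousLinearMap.fst ℝ _ _)).tendsto
  have hx3 := hx2.map (ContinuousLinearMap.snd ℝ _ _)
  have hu₀ := hx3.map (ContinuousLinearMap.fst ℝ _ _)
  have hu := hx3.map (ContinuousLinearMap.snd ℝ _ _)
  have key : ∀ (x : S.Unknowns m) (θ : A.Params), ‖S.forward A hσ x θ - target y‖ₑ ^ 2 =
      ‖S.timeDeriv x.2.2.2 - S.nemF x.1 x.2.2.2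
        - S.Lp_W.compLp (S.nemN A hσ x.2.1 x.2.2.2 θ)‖ₑ ^ 2 +
      (‖S.initial x.2.2.2 - S.U₀_H x.2.2.1‖ₑ ^ 2 + ‖S.M x.2.2.2 - y‖ₑ ^ 2) := by
    rintro ⟨lam, α, u₀, u⟩ θ
    rw [← enorm_sq_toLp_toLp]
    simp only [forward, target, ← WithLp.toLp_sub, Prod.mk_sub_mk, sub_zero]
  simp only [key]
  refine add_le_liminf_add (sq_le_liminf_sq (enorm_le_liminf_of_forall_subseq ?_))
    (add_le_liminf_add (sq_le_liminf_sq (WeakConv.enorm_le_liminf ?_))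
      (sq_le_liminf_sq (WeakConv.enorm_le_liminf ?_)))
  · intro φ r hφ hr
    exact norm_residual_le A hF hσ (hlam.subseq hφ) (hα.comp hφ.tendsto_atTop) (hu.subseq hφ)
      (hθ.comp hφ.tendsto_atTop) hr
  · exact (hu.map (S.evalAt _)).sub (hu₀.map S.U₀_H)
  · exact (hu.map S.M).sub (WeakConv.const y)

end Setting

end LearnPDE

theorem proposition3p2 {d m K : ℕ} {Ω : Set (EuclideanSpace ℝ (Fin d))} {T : ℝ} {p : ℝ≥0∞}
    [Fact (1 ≤ p)] {X V W Y Vt U₀ H : Type*}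
    [NormedAddCommGroup X] [NormedSpace ℝ X] [CompleteSpace X]
    [NormedAddCommGroup V] [NormedSpace ℝ V] [CompleteSpace V]
    [NormedAddCommGroup W] [NormedSpace ℝ W] [CompleteSpace W]
    [NormedAddCommGroup Y] [NormedSpace ℝ Y] [CompleteSpace Y]
    [NormedAddCommGroup Vt] [NormedSpace ℝ Vt] [CompleteSpace Vt]
    [NormedAddCommGroup U₀] [NormedSpace ℝ U₀] [CompleteSpace U₀]
    [NormedAddCommGroup H] [NormedSpace ℝ H] [CompleteSpace H]
    (S : Setting Ω T p X V W Y Vt U₀ H)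
    (hF : S.WeaklyContinuousModel ∨ S.PseudomonotoneModel)
    (A : Architecture m) (σ : ℝ → ℝ) (hσ : LocallyLipschitz σ)
    (R₁ : S.Unknowns m → ℝ≥0∞) (R₂ : A.Params → ℝ≥0∞)
    (hR₁ : WeaklyLSC R₁) (hR₂ : WeaklyLSC R₂)
    (hR₂_proper : ∃ θ, R₂ θ ≠ ⊤)
    (hR : ∀ c : ℝ≥0, WeaklyPrecompact {z : S.Unknowns m × A.Params | R₁ z.1 + R₂ z.2 ≤ c})
    (hK : 1 ≤ K) :
    (∀ y : Fin K → BochnerL2 T Y, ∃ z : (Fin K → S.Unknowns m) × A.Params,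
      ∀ z' : (Fin K → S.Unknowns m) × A.Params,
        S.learningObjective A hσ.continuous R₁ R₂ y z
          ≤ S.learningObjective A hσ.continuous R₁ R₂ y z') ∧
    (∀ (y : BochnerL2 T Y) (θ : A.Params), ∃ x : S.Unknowns m, ∀ x' : S.Unknowns m,
      S.identificationObjective A hσ.continuous R₁ y θ x
        ≤ S.identificationObjective A hσ.continuous R₁ y θ x') := by
  have hterm : ∀ (y : BochnerL2 T Y) {x : ℕ → S.Unknowns m} {x' : S.Unknowns m}
      {θ : ℕ → A.Params} {θ' : A.Params}, WeakConv x x' → Tendsto θ atTop (𝓝 θ') →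
      ‖S.forward A hσ.continuous x' θ' - Setting.target y‖ₑ ^ 2 + R₁ x' ≤
        liminf (fun n => ‖S.forward A hσ.continuous (x n) (θ n) - Setting.target y‖ₑ ^ 2
          + R₁ (x n)) atTop := fun y x x' θ θ' hx hθ =>
    add_le_liminf_add (Setting.misfit_le_liminf A hF hσ.continuous y hx hθ) (hR₁ _ _ hx)
  constructor
  · intro y
    refine exists_forall_le_of_subseq _ fun c z hz => ?_
    have hmem : ∀ (k : Fin K) n, ((z n).1 k, (z n).2) ∈
        {z : S.Unknowns m × A.Params | R₁ z.1 + R₂ z.2 ≤ c} := by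
      intro k n
      refine le_trans ?_ (hz n)
      refine add_le_add_left ?_ _
      have h1 := Finset.single_le_sum (f := fun k => ‖S.forward A hσ.continuous ((z n).1 k) (z n).2
        - Setting.target (y k)‖ₑ ^ 2 + R₁ ((z n).1 k)) (fun _ _ => zero_le) (Finset.mem_univ k)
      exact le_add_self.trans h1
    obtain ⟨φ, hφ, h⟩ := (hR c).exists_common_subseq Finset.univ hmem
    choose! a ha using fun k => h k (Finset.mem_univ k)
    have hx : ∀ k, WeakConv (fun n => (z (φ n)).1 k) (a k).1 := fun k =>
      (ha k).map (ContinuousLinearMap.fst ℝ _ _)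
    have hθ : ∀ k, WeakConv (fun n => (z (φ n)).2) (a k).2 := fun k =>
      (ha k).map (ContinuousLinearMap.snd ℝ _ _)
    let k₀ : Fin K := ⟨0, hK⟩
    refine ⟨(fun k => (a k).1, (a k₀).2), φ, hφ, ?_⟩
    exact add_le_liminf_add
      (sum_le_liminf_sum Finset.univ fun k => hterm (y k) (hx k) (hθ k₀).tendsto) (hR₂ _ _ (hθ k₀))
  · intro y θ
    obtain ⟨θ₀, hθ₀⟩ := hR₂_proper
    refine exists_forall_le_of_subseq _ fun c x hx => ?_
    obtain ⟨a, φ, hφ, ha⟩ := hR (c + (R₂ θ₀).toNNReal) (fun n => (x n, θ₀)) fun n => by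
      change R₁ (x n) + R₂ θ₀ ≤ _
      rw [ENNReal.coe_add, ENNReal.coe_toNNReal hθ₀]
      exact add_le_add_left (le_add_self.trans (hx n)) _
    exact ⟨a.1, φ, hφ, hterm y (ha.map (ContinuousLinearMap.fst ℝ _ _)) tendsto_const_nhds⟩
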